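/- **Setting.** Let $C\in\mathbb R_+^{n\times n}$, $C\neq 0$, let $\mathbf a,\mathbf b\in\mathbb R_+^n$ with $\sum_i a_i=\sum_j b_j=1$, and let $\varepsilon>0$. Write $\langle A,B\rangle=\sum_{i,j}A_{ij}B_{ij}$, $\|C\|_\infty=\max_{i,j}|C_{ij}|$, $a_{min}=\min_i a_i$, $b_{min}=\min_j b_j$, $m=\min\{a_{min},b_{min}\}$, $\kappa=1/m$, and $\Pi(\mathbf a,\mathbf b)=\{X\in\mathbb R_+^{n\times n}: X\mathbf 1=\mathbf a,\ X^\top\mathbf 1=\mathbf b\}$. Assume (A1): $a_{min}>0$ and $b_{min}>0$. **Parameters.** $\varepsilon'=\varepsilon/16$, $\eta=\varepsilon'/2$, $\gamma=\|C\|_\infty+\eta$, $\tau=16\|C\|_\infty n\gamma/\varepsilon$, and $$D=\|C\|_\infty+2\eta-\tau\min\{\log a_{min},\log b_{min}\},\quad \lambda=\frac{m}{\tau}e^{-D/\tau},\quad L=\frac1\tau+\lambda,\quad \mu=\min\Big\{\lambda,\frac1{2\eta}\Big\},$$ $$L_1=\|C\|_\infty+4\eta+2\tau\big|\log(\tfrac12me^{-D/\tau})\big|+2\tau\log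 2+\tau\max_i|\log a_i|+\tau\max_j|\log b_j|.$$ For $\mathbf x=(\mathbf u,\mathbf v,\mathbf t)\in\mathbb R^n\times\mathbb R^n\times\mathbb R^{n\times n}$ let $$w(\mathbf x)=\tfrac{\lambda}{2}\big(\|\mathbf u\|_2^2+\|\mathbf v\|_2^2\big)+\tfrac1{4\eta}\sum_{i,j}t_{ij}^2,\qquad f(\mathbf x)=\tau\sum_i a_ie^{-u_i/\tau}+\tau\sum_j b_je^{-v_j/\tau}-\tfrac{\lambda}{2}\big(\|\mathbf u\|_2^2+\|\mathbf v\|_2^2\big),$$ $h=f+w$, $P(\mathbf x_0,\mathbf x)=\big(w(\mathbf x)-w(\mathbf x_0)-\langle\nabla w(\mathbf x_0),\mathbf x-\mathbf x_0\rangle\big)/\mu$, $\mathcal X=\{\mathbf x: t_{ij}\ge 0,\ t_{ij}\ge u_i+v_j-C_{ij}\ \forall i,j\}$ and $V_D=\{\mathbf x:\tau\log a_i\le u_i\le D,\ \tau\log b_j\le v_j\le D\ \forall i,j\}$. The proximal mapping is $$\mathcal M(\mathbf g,\mathbf x_0,\theta)=\operatorname{argmin}_{\mathbf x\in V_D\cap\mathcal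 X}\ \langle\mathbf g,\mathbf x\rangle+w(\mathbf x)+\theta P(\mathbf x_0,\mathbf x).$$ **GEM-OT with $k$ iterations.** *(GEM-UOT)* Put $\alpha=1-1/(1+\sqrt{1+16L/\mu})$, $\psi=\frac1{1-\alpha}-1$, $\rho=\frac{\alpha}{1-\alpha}\mu$, $\mathbf x^0=\underline{\mathbf x}^0=\mathbf y^{-1}=\mathbf y^0=\mathbf 0$, $\theta_0=1$. For $t=1,\dots,k$ put $$\widetilde{\mathbf y}^t=\mathbf y^{t-1}+\alpha(\mathbf y^{t-1}-\mathbf y^{t-2}),\quad \mathbf x^t=\mathcal M(\widetilde{\mathbf y}^t,\mathbf x^{t-1},\rho),\quad \underline{\mathbf x}^t=\frac{\mathbf x^t+\psi\underline{\mathbf x}^{t-1}}{1+\psi},\quad \mathbf y^t=\nabla f(\underline{\mathbf x}^t),\quad \theta_t=\theta_{t-1}/\alpha.$$ Let $\bar{\mathbf t}$ be the $\mathbf t$-block of $(\sum_{t=1}^k\theta_t)^{-1}\sum_{t=1}^k\theta_t\mathbf x^t$ and let $\bar X=\bar{\mathbf t}/(2\eta)$. *(PROJ)* Multiply row $i$ of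 $\bar X$ by $\min\{1,a_i/(\bar X\mathbf 1)_i\}$ for every $i$ to get $X'$; multiply column $j$ of $X'$ by $\min\{1,b_j/(X'^\top\mathbf 1)_j\}$ for every $j$ to get $X''$; output $Y=X''+\mathbf r\mathbf c^\top/\|\mathbf r\|_1$ with $\mathbf r=\mathbf a-X''\mathbf 1$, $\mathbf c=\mathbf b-X''^\top\mathbf 1$ (and $Y=X''$ if $\mathbf r=\mathbf 0$). **Number of iterations.** For a minimiser $\mathbf x^*$ of $h$ over $\mathcal X$ let $\Delta=\mu P(\mathbf 0,\mathbf x^*)+h(\mathbf 0)-h(\mathbf x^*)+\|\nabla f(\mathbf 0)\|_2^2/\mu$ and $$K_0=4\big(1+\sqrt{1+16L/\mu}\big)\log\Big(\frac{4n^2}{\eta}\sqrt{\frac{\Delta}{\mu}}\ \max\Big\{\frac{L_1}{\varepsilon'},\frac{e^{D/\tau}}{m},\frac12\Big\}\Big).$$ **Theorem.** A minimiser $\mathbf x^*$ exists, and: 1. For every integer $k\ge K_0$, GEM-OT with $k$ iterations outputs $Y\in\Pi(\mathbf a,\mathbf b)$ with $\langle C,Y\rangle\le\langle C,X^{OT}\rangle+\varepsilon$,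 where $X^{OT}$ is a minimiser of $\langle C,\cdot\rangle$ over $\Pi(\mathbf a,\mathbf b)$ (which exists). 2. Count one step for every arithmetic operation, comparison, square root, exponential or logarithm of real numbers, and $c\,(n^2+2n)$ steps for every evaluation of $\mathcal M$ (a separable quadratic program in $n^2+2n$ variables), where $c\in\mathbb N$ is fixed. Assume (A2): $|\log a_{min}|\le c_0\log n$ and $|\log b_{min}|\le c_0\log n$, and let $n\ge2$ and $\varepsilon\le\|C\|_\infty$. Then GEM-OT with $k=\max\{0,\lceil K_0\rceil\}$ iterations takes at most $$M\,\kappa\,n^2\log\Big(\frac{n\|C\|_\infty}{\varepsilon}\Big)$$ steps, where $M$ depends only on $c$ and $c_0$; that is, the complexity of GEM-OT is $O\big(\kappa n^2\log(n\|C\|_\infty/\varepsilon)\big)$. -/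

import Mathlib

open scoped BigOperators

noncomputable section

namespace GEM

/-! ## Step counting: a real-arithmetic machine

A value of type `Timed β` is the result of a computation with the number of elementary steps used
to obtain it.  Sequencing adds step counts.  Every arithmetic operation, comparison, and evaluation
of `exp`, `log` or the square root on real numbers is one step; reading a stored number is free. -/

/-- A computed value together with the number of elementary steps spent on it. -/
structure Timed (β : Type) : Type where
  val : β
  steps : ℕ

namespace Timed

instance : Monad Timed where
  pure x := ⟨x, 0⟩
  bind p f := ⟨(f p.val).val, p.steps + (f p.val).steps⟩

/-- Read a stored number. -/
def rd (x : ℝ) : Timed ℝ := ⟨x, 0⟩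

instance (k : ℕ) [OfNat ℝ k] : OfNat (Timed ℝ) k := ⟨rd (OfNat.ofNat k)⟩
instance : Add (Timed ℝ) := ⟨fun p q => ⟨p.val + q.val, p.steps + q.steps + 1⟩⟩
instance : Sub (Timed ℝ) := ⟨fun p q => ⟨p.val - q.val, p.steps + q.steps + 1⟩⟩
instance : Mul (Timed ℝ) := ⟨fun p q => ⟨p.val * q.val, p.steps + q.steps + 1⟩⟩
instance : Div (Timed ℝ) := ⟨fun p q => ⟨p.val / q.val, p.steps + q.steps + 1⟩⟩
instance : Neg (Timed ℝ) := ⟨fun p => ⟨-p.val, p.steps + 1⟩⟩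

/-- Minimum of two numbers, one step. -/
def tmin (p q : Timed ℝ) : Timed ℝ := ⟨min p.val q.val, p.steps + q.steps + 1⟩
/-- Absolute value, one step. -/
def tabs (p : Timed ℝ) : Timed ℝ := ⟨|p.val|, p.steps + 1⟩
/-- Exponential, one step. -/
def texp (p : Timed ℝ) : Timed ℝ := ⟨Real.exp p.val, p.steps + 1⟩
/-- Natural logarithm, one step. -/
def tlog (p : Timed ℝ) : Timed ℝ := ⟨Real.log p.val, p.steps + 1⟩
/-- Square root, one step. -/
def tsqrt (p : Timed ℝ) : Timed ℝ := ⟨Real.sqrt p.val, p.steps + 1⟩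

variable {n : ℕ}

/-- Compute and store `n` values, one after the other. -/
def tab {β : Type} (f : Fin n → Timed β) : Timed (Fin n → β) :=
  ⟨fun i => (f i).val, ∑ i, (f i).steps⟩

/-- Compute `n` numbers and add them up, one step for each addition. -/
def sumT (f : Fin n → Timed ℝ) : Timed ℝ := ⟨∑ i, (f i).val, ∑ i, ((f i).steps + 1)⟩

/-- Compute `n` numbers and their smallest one, one step for each comparison. -/
def minT (f : Fin n → Timed ℝ) : Timed ℝ := ⟨⨅ i, (f i).val, ∑ i, ((f i).steps + 1)⟩

/-- Compute `n` numbers and their largest one, one step for each comparison. -/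
def maxT (f : Fin n → Timed ℝ) : Timed ℝ := ⟨⨆ i, (f i).val, ∑ i, ((f i).steps + 1)⟩

/-- Run the loop body `f` exactly `k` times, starting from `s`. -/
def loop {σ : Type} (f : σ → Timed σ) : ℕ → σ → Timed σ
  | 0, s => pure s
  | k + 1, s => do
    let s' ← loop f k s
    f s'

end Timed

/-! ## Transport plans -/

/-- Square real matrices. -/
abbrev Mat (n : ℕ) : Type := Fin n → Fin n → ℝ

/-- Frobenius inner product `⟨A, B⟩`. -/
def frob {n : ℕ} (A B : Mat n) : ℝ := ∑ i, ∑ j, A i j * B i j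

/-- `‖C‖_∞`, the largest absolute value of an entry. -/
def normInf {n : ℕ} (C : Mat n) : ℝ := ⨆ i, ⨆ j, |C i j|

/-- Nonnegative vectors of total mass one. -/
def simplex (n : ℕ) : Set (Fin n → ℝ) := {a | (∀ i, 0 ≤ a i) ∧ ∑ i, a i = 1}

/-- `Π(a, b)`: nonnegative matrices with row sums `a` and column sums `b`. -/
def couplings {n : ℕ} (a b : Fin n → ℝ) : Set (Mat n) :=
  {X | (∀ i j, 0 ≤ X i j) ∧ (∀ i, ∑ j, X i j = a i) ∧ (∀ j, ∑ i, X i j = b j)}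

/-- `X` is an optimal transportation plan of `OT(a, b)` for the cost `C`. -/
def IsOptimalPlan {n : ℕ} (C : Mat n) (a b : Fin n → ℝ) (X : Mat n) : Prop :=
  X ∈ couplings a b ∧ ∀ Z ∈ couplings a b, frob C X ≤ frob C Z

/-- `Y` is an `ε`-approximate transportation plan of `OT(a, b)` for the cost `C`. -/
def IsApproxPlan {n : ℕ} (C : Mat n) (a b : Fin n → ℝ) (ε : ℝ) (Y : Mat n) : Prop :=
  Y ∈ couplings a b ∧ ∃ X, IsOptimalPlan C a b X ∧ frob C Y ≤ frob C X + ε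

/-- Smallest entry of a vector. -/
def minEntry {n : ℕ} (a : Fin n → ℝ) : ℝ := ⨅ i, a i

/-- `κ = 1 / min (a_min, b_min)`. -/
def kappa {n : ℕ} (a b : Fin n → ℝ) : ℝ := 1 / min (minEntry a) (minEntry b)

/-! ## The dual of squared-`ℓ²`-regularised, KL-penalised unbalanced transport -/

/-- The data of a regularised unbalanced transport problem: cost matrix, the two masses, the
marginal penalty `τ` and the regularisation parameter `η`. -/
structure UOT (n : ℕ) where
  C : Mat n
  a : Fin n → ℝ
  b : Fin n → ℝ
  τ : ℝ
  η : ℝ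

/-- Dual variables `x = (u, v, t)`. -/
abbrev Var (n : ℕ) : Type := (Fin n → ℝ) × (Fin n → ℝ) × (Fin n → Fin n → ℝ)

/-- Euclidean inner product of dual variables. -/
def dot {n : ℕ} (x y : Var n) : ℝ :=
  ∑ i, x.1 i * y.1 i + ∑ j, x.2.1 j * y.2.1 j + ∑ i, ∑ j, x.2.2 i j * y.2.2 i j

namespace UOT

variable {n : ℕ} (P : UOT n)

/-- The total mass `α + β`. -/
def mass : ℝ := ∑ i, P.a i + ∑ j, P.b j

/-- `min (a_min, b_min)`. -/
def low : ℝ := min (minEntry P.a) (minEntry P.b)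

def D : ℝ :=
  normInf P.C + P.η * P.mass + P.τ * Real.log (P.mass / 2)
    - P.τ * min (Real.log (minEntry P.a)) (Real.log (minEntry P.b))

/-- The coefficient `min (a_min, b_min) e^{-D/τ} / τ`. -/
def modulus : ℝ := P.low / P.τ * Real.exp (-(P.D / P.τ))

/-- Smoothness constant `L`. -/
def L : ℝ := P.mass / (2 * P.τ) + P.modulus

/-- Strong convexity constant `μ`. -/
def mu : ℝ := min P.modulus (1 / (2 * P.η))

def p : ℝ := 1 / 2 * P.low * Real.exp (-(P.D / P.τ))

def q : ℝ := P.mass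

def L₁ : ℝ :=
  normInf P.C + 2 * P.η * P.q + 2 * P.τ * |Real.log P.p| + 2 * P.τ * |Real.log P.q|
    + P.τ * (⨆ i, |Real.log (P.a i)|) + P.τ * (⨆ j, |Real.log (P.b j)|)

/-- The dual feasible set `𝒳`. -/
def feasible : Set (Var n) :=
  {x | ∀ i j, 0 ≤ x.2.2 i j ∧ x.1 i + x.2.1 j - P.C i j ≤ x.2.2 i j}

/-- The localisation set `V_D`. -/
def box : Set (Var n) :=
  {x | (∀ i, P.τ * Real.log (2 * P.a i / P.mass) ≤ x.1 i ∧ x.1 i ≤ P.D) ∧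
       (∀ j, P.τ * Real.log (2 * P.b j / P.mass) ≤ x.2.1 j ∧ x.2.1 j ≤ P.D)}

/-- The dual objective `h_η`, to be minimised over `𝒳`. -/
def h (x : Var n) : ℝ :=
  1 / (4 * P.η) * ∑ i, ∑ j, x.2.2 i j ^ 2
    + P.τ * ∑ i, Real.exp (-(x.1 i / P.τ)) * P.a i
    + P.τ * ∑ j, Real.exp (-(x.2.1 j / P.τ)) * P.b j

/-- The strongly convex part `w_η`. -/
def w (x : Var n) : ℝ :=
  P.modulus / 2 * (∑ i, x.1 i ^ 2 + ∑ j, x.2.1 j ^ 2)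
    + 1 / (4 * P.η) * ∑ i, ∑ j, x.2.2 i j ^ 2

/-- The smooth part `f_η`; `h = f + w`. -/
def f (x : Var n) : ℝ :=
  P.τ * ∑ i, Real.exp (-(x.1 i / P.τ)) * P.a i
    + P.τ * ∑ j, Real.exp (-(x.2.1 j / P.τ)) * P.b j
    - P.modulus / 2 * (∑ i, x.1 i ^ 2 + ∑ j, x.2.1 j ^ 2)

/-- The gradient of `f_η`. -/
def gradF (x : Var n) : Var n :=
  (fun i => -(P.a i * Real.exp (-(x.1 i / P.τ))) - P.modulus * x.1 i,
   fun j => -(P.b j * Real.exp (-(x.2.1 j / P.τ))) - P.modulus * x.2.1 j,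
   fun _ _ => 0)

/-- The gradient of `w_η`. -/
def gradW (x : Var n) : Var n :=
  (fun i => P.modulus * x.1 i,
   fun j => P.modulus * x.2.1 j,
   fun i j => 1 / (2 * P.η) * x.2.2 i j)

/-- The prox-function `P(x₀, x)`. -/
def bregman (x₀ x : Var n) : ℝ := (P.w x - (P.w x₀ + dot (P.gradW x₀) (x - x₀))) / P.mu

/-- `x` minimises `⟨g, ·⟩ + w_η + θ P(x₀, ·)` over `V_D ∩ 𝒳`. -/
def IsProx (g x₀ : Var n) (θ : ℝ) (x : Var n) : Prop :=
  x ∈ P.box ∩ P.feasible ∧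
    IsMinOn (fun z => dot g z + P.w z + θ * P.bregman x₀ z) (P.box ∩ P.feasible) x

/-- The proximal mapping `ℳ_{V_D ∩ 𝒳}(g, x₀, θ)`, the minimiser (a strongly convex objective on a
closed convex set). -/
def prox (g x₀ : Var n) (θ : ℝ) : Var n := Classical.epsilon (P.IsProx g x₀ θ)

/-- `x` is an optimal solution of the dual problem `min_𝒳 h_η`. -/
def IsDualSolution (x : Var n) : Prop := x ∈ P.feasible ∧ IsMinOn P.h P.feasible x

/-- `Δ_{0,σ₀}` for the starting point `0` and the dual solution `xs`. -/
def Delta (xs : Var n) : ℝ :=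
  P.mu * P.bregman 0 xs + P.h 0 - P.h xs + dot (P.gradF 0) (P.gradF 0) / P.mu

/-- The number `K₀` of iterations of the gradient extrapolation method for target accuracy `ε`. -/
def K₀ (ε : ℝ) (xs : Var n) : ℝ :=
  4 * (1 + Real.sqrt (1 + 16 * P.L / P.mu)) *
    Real.log (4 * (n : ℝ) ^ 2 * Real.sqrt (P.Delta xs / P.mu) / P.η *
      max (P.L₁ / ε) (max (Real.exp (P.D / P.τ) / P.low) (1 / P.mass)))

end UOT

/-! ## The algorithms -/

open Timed

variable {n : ℕ}

/-- Apply a scalar operation to the corresponding entries of two dual variables. -/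
def combine (g : ℝ → ℝ → Timed ℝ) (x y : Var n) : Timed (Var n) := do
  let u ← tab fun i => g (x.1 i) (y.1 i)
  let v ← tab fun j => g (x.2.1 j) (y.2.1 j)
  let t ← tab fun i => tab fun j => g (x.2.2 i j) (y.2.2 i j)
  pure (u, v, t)

/-- One evaluation of the proximal mapping: a separable quadratic program in `n² + 2n` scalar
variables, charged `c` steps for each of them. -/
def proxOracle (c : ℕ) (P : UOT n) (g x₀ : Var n) (θ : ℝ) : Timed (Var n) :=
  ⟨P.prox g x₀ θ, c * (n ^ 2 + 2 * n)⟩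

/-- `‖C‖_∞`. -/
def normProg (C : Mat n) : Timed ℝ := maxT fun i => maxT fun j => tabs (rd (C i j))

/-- The constants computed once by GEM-UOT: the modulus of `w_η`, `α`, `ψ` and `ρ`. -/
structure Consts where
  modulus : ℝ
  α : ℝ
  ψ : ℝ
  ρ : ℝ

def constsProg (P : UOT n) : Timed Consts := do
  let normC ← normProg P.C
  let sa ← sumT fun i => rd (P.a i)
  let sb ← sumT fun j => rd (P.b j)
  let m ← rd sa + rd sb
  let amin ← minT fun i => rd (P.a i)
  let bmin ← minT fun j => rd (P.b j)
  let low ← tmin (rd amin) (rd bmin)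
  let D ← rd normC + rd P.η * rd m + rd P.τ * tlog (rd m / 2)
    - rd P.τ * tmin (tlog (rd amin)) (tlog (rd bmin))
  let s ← rd low / rd P.τ * texp (-(rd D / rd P.τ))
  let L ← rd m / (2 * rd P.τ) + rd s
  let μ ← tmin (rd s) (1 / (2 * rd P.η))
  let α ← 1 - 1 / (1 + tsqrt (1 + 16 * rd L / rd μ))
  let ψ ← 1 / (1 - rd α) - 1
  let ρ ← rd α / (1 - rd α) * rd μ
  pure ⟨s, α, ψ, ρ⟩

/-- The gradient of `f_η`, computed entrywise. -/
def gradProg (P : UOT n) (K : Consts) (x : Var n) : Timed (Var n) := do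
  let u ← tab fun i =>
    -(rd (P.a i) * texp (-(rd (x.1 i) / rd P.τ))) - rd K.modulus * rd (x.1 i)
  let v ← tab fun j =>
    -(rd (P.b j) * texp (-(rd (x.2.1 j) / rd P.τ))) - rd K.modulus * rd (x.2.1 j)
  pure (u, v, fun _ _ => 0)

/-- Memory of GEM-UOT after iteration `t`: `xᵗ`, the extrapolation point `x̲ᵗ`, `yᵗ`, `yᵗ⁻¹`, `θ_t`,
and the running sums `∑ θ_s xˢ`, `∑ θ_s` over `1 ≤ s ≤ t`. -/
structure State (n : ℕ) where
  x : Var n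
  xbar : Var n
  y : Var n
  yprev : Var n
  θ : ℝ
  acc : Var n
  wt : ℝ

/-- One iteration of GEM-UOT. -/
def iteration (c : ℕ) (P : UOT n) (K : Consts) (s : State n) : Timed (State n) := do
  let ytilde ← combine (fun p q => rd p + rd K.α * (rd p - rd q)) s.y s.yprev
  let x ← proxOracle c P ytilde s.x K.ρ
  let xbar ← combine (fun p q => (rd p + rd K.ψ * rd q) / (1 + rd K.ψ)) x s.xbar
  let y ← gradProg P K xbar
  let θ ← rd s.θ / rd K.α
  let acc ← combine (fun p q => rd p + rd θ * rd q) s.acc x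
  let wt ← rd s.wt + rd θ
  pure ⟨x, xbar, y, s.y, θ, acc, wt⟩

/-- GEM-UOT with `k` iterations: the primal matrix `t / (2η)`, where `t` is the last block of the
weighted average of the iterates. -/
def gemUOT (c k : ℕ) (P : UOT n) : Timed (Mat n) := do
  let K ← constsProg P
  let s ← loop (iteration c P K) k ⟨0, 0, 0, 0, 1, 0, 0⟩
  tab fun i => tab fun j => (rd (s.acc.2.2 i j) / rd s.wt) / (2 * rd P.η)

/-- The rounding procedure PROJ.  Here division by zero gives zero, so a zero row or column
is left unchanged and the correction is dropped if the row error vanishes. -/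
def proj (X : Mat n) (a b : Fin n → ℝ) : Timed (Mat n) := do
  let r ← tab fun i => sumT fun j => rd (X i j)
  let x ← tab fun i => tmin (rd (a i) / rd (r i)) 1
  let X' ← tab fun i => tab fun j => rd (x i) * rd (X i j)
  let s ← tab fun j => sumT fun i => rd (X' i j)
  let y ← tab fun j => tmin (rd (b j) / rd (s j)) 1
  let X'' ← tab fun i => tab fun j => rd (X' i j) * rd (y j)
  let er ← tab fun i => rd (a i) - sumT fun j => rd (X'' i j)
  let ec ← tab fun j => rd (b j) - sumT fun i => rd (X'' i j)
  let e ← sumT fun i => tabs (rd (er i))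
  tab fun i => tab fun j => rd (X'' i j) + rd (er i) * rd (ec j) / rd e

/-- The parameter tuning of GEM-OT: `ε' = ε/16`, `η = ε'/2`, `γ = ‖C‖_∞ + η`,
`τ = 16 ‖C‖_∞ n γ / ε`. -/
def tunedProg (C : Mat n) (a b : Fin n → ℝ) (ε : ℝ) : Timed (UOT n) := do
  let ε' ← rd ε / 16
  let η ← rd ε' / 2
  let normC ← normProg C
  let γ ← rd normC + rd η
  let τ ← 16 * rd normC * rd (n : ℝ) * rd γ / rd ε
  pure ⟨C, a, b, τ, η⟩

/-- The regularised unbalanced problem that GEM-OT hands to GEM-UOT. -/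
def tuned (C : Mat n) (a b : Fin n → ℝ) (ε : ℝ) : UOT n := (tunedProg C a b ε).val

/-- GEM-OT with `k` iterations of GEM-UOT. -/
def gemOT (c k : ℕ) (C : Mat n) (a b : Fin n → ℝ) (ε : ℝ) : Timed (Mat n) := do
  let P ← tunedProg C a b ε
  let X ← gemUOT c k P
  proj X a b

end GEM

end

open scoped BigOperators

noncomputable section

namespace GEM

open Set

/-! The optimal transport problem is relaxed twice: the marginal constraints become KL penalties of
weight `τ`, and the plan is regularised by a squared norm of weight `η`. The dual of the relaxed
problem is the minimisation of `h = f + w` over a polyhedron, and the relaxed plan is read off a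
dual solution as `t / (2η)`. Three facts carry the accuracy claim.

(a) Geometry of a dual solution. Stationarity and complementary slackness (`isKKT`) show that its
plan has row sums `a_i exp(-u_i/τ)`, column sums `b_j exp(-v_j/τ)` and mass at most one
(`mass_le_one`). Hence all potentials are at most `‖C‖ + 2η` in absolute value (`abs_u_le`,
`abs_v_le`). So the solution lies in the box (`mem_box`), and for large `τ` the marginals are nearly
`a` and `b`. The plan costs at most `η / 2` more than any coupling (`frob_plan_le`).

(b) Linear convergence. On the box `f` is separable, convex and smooth, hence cocoercive
(`f_cocoercive`), and `w` is a quadratic form that is `μ`-strongly convex. An abstract potential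
argument (`gradient_extrapolation_step`, `gradient_extrapolation_rate`) contracts by `s / (1 + s)`
per iteration, where `s = √(1 + 16L/μ)`. The weights of the average grow at the inverse rate, and
the averaged `t` inherits the square root of the contraction (`run_average_dist`).

(c) Rounding. `proj_spec` turns a nonnegative matrix into a coupling at a cost of `‖C‖` times its
total marginal defect. With the tuned parameters all errors sum to less than `ε`
(`gemOT_isApproxPlan`).

For the complexity, one iteration takes `O(n²)` steps. In `L / μ` the factors `τ` cancel and leave
`O(κ²)`, so `s = O(κ)` (`root_le`). The argument of the logarithm in `K₀` is polynomial in `T =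
n‖C‖/ε` and `κ` (`conditioning_le`), and (A2) bounds `κ` by a power of `n ≤ T`. Thus `K₀ = O(κ log
T)`. -/

/-! ### Scalar inequalities. -/

/-- One-dimensional cocoercivity on an interval. -/
theorem sq_deriv_sub_le_bregman {φ g g' : ℝ → ℝ} {L lo hi : ℝ} (hL : 0 < L)
    (hφ : ∀ y, HasDerivAt φ (g y) y) (hg : ∀ y, HasDerivAt g (g' y) y)
    (h0 : ∀ y ∈ Icc lo hi, 0 ≤ g' y) (h1 : ∀ y ∈ Icc lo hi, g' y ≤ L)
    {x y : ℝ} (hx : x ∈ Icc lo hi) (hy : y ∈ Icc lo hi) :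
    φ x + g x * (y - x) + 1 / (2 * L) * (g y - g x) ^ 2 ≤ φ y := by
  have hgm : MonotoneOn g (Icc lo hi) := by
    refine monotoneOn_of_deriv_nonneg (convex_Icc _ _)
      (fun z _ => (hg z).continuousAt.continuousWithinAt)
      (fun z _ => (hg z).differentiableAt.differentiableWithinAt) fun z hz => ?_
    rw [(hg z).deriv]
    exact h0 z (interior_subset hz)
  -- The claim is `ψ x ≤ ψ y`. The derivative of `ψ` is a product of `g z - g x`, which has the sign
  -- of `z - x`, and a nonnegative factor, so `ψ` is smallest at `x`. Only points between `x` and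
  -- `y` enter, so the bounds on `g'` are needed on the interval alone.
  set ψ : ℝ → ℝ := fun z => φ z - g x * z - 1 / (2 * L) * (g z - g x) ^ 2 with hψ
  have hd : ∀ z, HasDerivAt ψ ((g z - g x) * (1 - g' z / L)) z := by
    intro z
    have := ((hφ z).sub ((hasDerivAt_id z).const_mul (g x))).sub
      ((((hg z).sub_const (g x)).pow 2).const_mul (1 / (2 * L)))
    refine this.congr_deriv ?_
    field_simp
    push_cast
    ring
  have hfac : ∀ z ∈ Icc lo hi, 0 ≤ 1 - g' z / L := fun z hz => by
    have := (div_le_one hL).2 (h1 z hz)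
    linarith
  have key : ψ x ≤ ψ y := by
    rcases le_total x y with hxy | hyx
    · have hm : MonotoneOn ψ (Icc x y) := by
        refine monotoneOn_of_deriv_nonneg (convex_Icc _ _)
          (fun z _ => (hd z).continuousAt.continuousWithinAt)
          (fun z _ => (hd z).differentiableAt.differentiableWithinAt) fun z hz => ?_
        rw [(hd z).deriv]
        have hz' := interior_subset hz
        have hz2 : z ∈ Icc lo hi := ⟨hx.1.trans hz'.1, hz'.2.trans hy.2⟩
        exact mul_nonneg (sub_nonneg.2 (hgm hx hz2 hz'.1)) (hfac z hz2)
      exact hm (left_mem_Icc.2 hxy) (right_mem_Icc.2 hxy) hxy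
    · have hm : AntitoneOn ψ (Icc y x) := by
        refine antitoneOn_of_deriv_nonpos (convex_Icc _ _)
          (fun z _ => (hd z).continuousAt.continuousWithinAt)
          (fun z _ => (hd z).differentiableAt.differentiableWithinAt) fun z hz => ?_
        rw [(hd z).deriv]
        have hz' := interior_subset hz
        have hz2 : z ∈ Icc lo hi := ⟨hy.1.trans hz'.1, hz'.2.trans hx.2⟩
        exact mul_nonpos_of_nonpos_of_nonneg (sub_nonpos.2 (hgm hz2 hx hz'.2)) (hfac z hz2)
      exact hm (left_mem_Icc.2 hyx) (right_mem_Icc.2 hyx) hyx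
  simp only [hψ, sub_self] at key
  linarith

/-- A quadratic that is nonnegative near zero from the right has nonnegative slope at zero. -/
theorem nonneg_of_forall_quadratic {A B : ℝ} (h : ∀ r : ℝ, 0 ≤ r → r ≤ 1 → 0 ≤ r * A + r ^ 2 * B) :
    0 ≤ A := by
  by_contra hA
  push Not at hA
  have hB : 0 ≤ |B| := abs_nonneg B
  have hpos : 0 < -A / (|B| - A) := div_pos (by linarith) (by linarith)
  have hle : -A / (|B| - A) ≤ 1 := (div_le_one (by linarith)).2 (by linarith)
  -- Small enough that `r * |B|` cannot compensate the negative slope `A`, and well defined also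
  -- when `B = 0`.
  set r := -A / (|B| - A) / 2 with hr
  have h1 := h r (by positivity) (by linarith)
  have h2 : r * (|B| - A) = -A / 2 := by
    rw [hr]; field_simp [show |B| - A ≠ 0 by linarith]
  have h3 : r * A + r ^ 2 * B ≤ r * (A + r * |B|) := by
    have := mul_le_mul_of_nonneg_left (le_abs_self B) (sq_nonneg r)
    linarith
  have hr0 : 0 < r := by rw [hr]; positivity
  have h4 : A + r * |B| < 0 := by nlinarith
  nlinarith

/-! ### Gradient extrapolation for an abstract quadratic prox function. -/

section Rate

variable {E : Type*} [AddCommGroup E] [Module ℝ E] (B Q : LinearMap.BilinForm ℝ E)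

/-- One step of gradient extrapolation contracts the potential.  Here `a = x₁ - xs`, `d = x₁ - x₀`,
`p` and `e` are the extrapolation points relative to `xs`, `z` and `g` are the differences of the
gradient at the previous extrapolation point with the new and the old dual iterate. -/
theorem gradient_extrapolation_step (hB : ∀ x y, B x y = B y x) (hQ : ∀ x y, Q x y = Q y x)
    (hB0 : ∀ x, 0 ≤ B x x) {μ L s : ℝ} (hμ : 0 < μ) (hL : 0 < L) (hs : 1 ≤ s)
    (hsL : 16 * L ≤ s ^ 2 * μ) (hQμ : ∀ x, μ * B x x ≤ Q x x)
    {fs fb₀ fb₁ : ℝ} {xs ys a d p e y₁ g z δ₀ : E} (ha : a = (1 + s) • p - s • e)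
    (hxs : 0 ≤ B ys a + Q xs a)
    (hprox : 0 ≤ -B (y₁ - (g - z) + (s / (1 + s)) • δ₀) a - Q (xs + a) a - s * Q d a)
    (hco₁ : fb₁ - B y₁ p ≤ fs)
    (hco₂ : fb₁ + B y₁ (e - p) + 1 / (2 * L) * B z z ≤ fb₀) :
    (1 + s) / 2 * Q a a + (1 + s) * (fb₁ - fs - B ys p)
        - B (g - z) a + 1 / ((1 + s) * μ) * B (g - z) (g - z)
      ≤ s / (1 + s) * ((1 + s) / 2 * Q (a - d) (a - d)
        + (1 + s) * (fb₀ - fs - B ys e) - B δ₀ (a - d)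
        + 1 / ((1 + s) * μ) * B δ₀ δ₀) + 2 / ((1 + s) * μ) * B g g := by
  have hs1 : 0 < 1 + s := by linarith
  have ey1 : B y₁ a = (1 + s) * B y₁ p - s * B y₁ e := by simp [ha]
  have eys : B ys a = (1 + s) * B ys p - s * B ys e := by simp [ha]
  have young := hB0 (δ₀ + ((1 + s) * μ) • d)
  have par := hB0 (g + z)
  have hQa : 0 ≤ Q a a := (mul_nonneg hμ.le (hB0 a)).trans (hQμ a)
  have hQd := hQμ d
  simp only [map_add, map_sub, map_smul, LinearMap.add_apply, LinearMap.sub_apply,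
    LinearMap.smul_apply, smul_eq_mul, hB g z, hB d δ₀, hQ a d, ey1, eys] at *
  -- `young` will absorb the cross term of `δ₀` and `d` into `Q d d`, which the three-point
  -- expansion of `Q (a - d) (a - d)` supplies; `par` bounds the square of `g - z` by twice the
  -- squares of `g` and `z`.
  rw [hB z g, hB δ₀ d] at *
  -- The square of `z` is paid for by the cocoercivity gain, weighted by `s`; this is where `s` must
  -- dominate the square root of `L / μ`.
  have c1 : 1 / ((1 + s) * μ) * (2 * B z z) ≤ s * (1 / (2 * L) * B z z) := by
    have : 1 / ((1 + s) * μ) * 2 ≤ s * (1 / (2 * L)) := by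
      rw [div_mul_eq_mul_div, mul_one_div, div_le_div_iff₀ (by positivity) (by positivity)]
      nlinarith
    nlinarith [mul_le_mul_of_nonneg_right this (hB0 z)]
  have c2 := mul_le_mul_of_nonneg_left hco₂ (show 0 ≤ s by linarith)
  have rhs : ∀ X Y Z W : ℝ, s / (1 + s) * ((1 + s) / 2 * X + (1 + s) * Y - Z
      + 1 / ((1 + s) * μ) * W) = s / 2 * X + s * Y - s / (1 + s) * Z
        + s / (1 + s) * (1 / ((1 + s) * μ)) * W := fun X Y Z W => by field_simp
  have two : 2 / ((1 + s) * μ) = 2 * (1 / ((1 + s) * μ)) := by ring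
  rw [rhs, two]
  have hα0 : 0 ≤ s / (1 + s) := by positivity
  have hα : s / (1 + s) * (1 + s) = s := by field_simp
  have hβ0 : 0 ≤ 1 / ((1 + s) * μ) := by positivity
  have hβ : 1 / ((1 + s) * μ) * ((1 + s) * μ) = 1 := by field_simp
  generalize s / (1 + s) = α at *
  generalize 1 / ((1 + s) * μ) = β at *
  have y1 := mul_nonneg (mul_nonneg hα0 hβ0) young
  have y2 : α * β * (B δ₀ δ₀ + (1 + s) * μ * B d δ₀ + (1 + s) * μ * (B d δ₀ + (1 + s) * μ * B d d))
      = α * β * B δ₀ δ₀ + 2 * α * B d δ₀ + s * (μ * B d d) := by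
    linear_combination (2 * α * B d δ₀ + α * (1 + s) * μ * B d d) * hβ + μ * B d d * hα
  rw [y2] at y1
  have y3 := mul_le_mul_of_nonneg_left hQd (show 0 ≤ s by linarith)
  have y4 := mul_nonneg (mul_nonneg hα0 hβ0) (hB0 δ₀)
  have y5 := mul_nonneg hβ0 par
  linarith

/-- Linear convergence of gradient extrapolation started from a zero dual iterate. -/
theorem gradient_extrapolation_rate (hB : ∀ x y, B x y = B y x) (hQ : ∀ x y, Q x y = Q y x)
    (hB0 : ∀ x, 0 ≤ B x x) {μ L s : ℝ} (hμ : 0 < μ) (hL : 0 < L) (hs : 1 ≤ s)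
    (hsL : 16 * L ≤ s ^ 2 * μ) (hQμ : ∀ x, μ * B x x ≤ Q x x) {V : Set E} {f : E → ℝ} {G : E → E}
    (hco : ∀ x ∈ V, ∀ y ∈ V,
      f x + B (G x) (y - x) + 1 / (2 * L) * B (G y - G x) (G y - G x) ≤ f y)
    {xs : E} (hxsV : xs ∈ V) (hxs : ∀ z ∈ V, 0 ≤ B (G xs) (z - xs) + Q xs (z - xs))
    {x xb y δ : ℕ → E} (hx : ∀ k, x k ∈ V) (hxbV : ∀ k, xb k ∈ V) (hy0 : y 0 = 0)
    (hδ0 : δ 0 = 0) (hδ : ∀ k, δ (k + 1) = y (k + 1) - y k)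
    (hy : ∀ k, y (k + 1) = G (xb (k + 1)))
    (hprox : ∀ k, ∀ z ∈ V, 0 ≤ B (y k + (s / (1 + s)) • δ k) (z - x (k + 1))
      + Q (x (k + 1)) (z - x (k + 1)) + s * Q (x (k + 1) - x k) (z - x (k + 1)))
    (hxb : ∀ k, (1 + s) • xb (k + 1) = x (k + 1) + s • xb k) (k : ℕ) :
    (1 + s) / 4 * Q (x k - xs) (x k - xs) ≤ (s / (1 + s)) ^ k *
      ((1 + s) / 2 * Q (x 0 - xs) (x 0 - xs)
        + (1 + s) * (f (xb 0) - f xs - B (G xs) (xb 0 - xs))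
        + 2 / (s * μ) * B (G (xb 0)) (G (xb 0))) := by
  have hs1 : 0 < 1 + s := by linarith
  have hsq : ∀ x, 0 ≤ 1 / (2 * L) * B x x := fun x => mul_nonneg (by positivity) (hB0 x)
  set Φ : ℕ → ℝ := fun k => (1 + s) / 2 * Q (x k - xs) (x k - xs)
    + (1 + s) * (f (xb k) - f xs - B (G xs) (xb k - xs)) - B (δ k) (x k - xs)
    + 1 / ((1 + s) * μ) * B (δ k) (δ k) with hΦ
  have hstep : ∀ k, Φ (k + 1) ≤ s / (1 + s) * Φ k
      + 2 / ((1 + s) * μ) * B (G (xb k) - y k) (G (xb k) - y k) := by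
    intro k
    have h := gradient_extrapolation_step B Q hB hQ hB0 hμ hL hs hsL hQμ
      (fs := f xs) (fb₀ := f (xb k)) (fb₁ := f (xb (k + 1))) (xs := xs) (ys := G xs)
      (a := x (k + 1) - xs) (d := x (k + 1) - x k) (p := xb (k + 1) - xs) (e := xb k - xs)
      (y₁ := y (k + 1)) (g := G (xb k) - y k) (z := G (xb k) - y (k + 1)) (δ₀ := δ k)
      (by
        have := hxb k
        rw [smul_sub, smul_sub, this]; module)
      (hxs _ (hx _))
      (by
        have h := hprox k xs hxsV
        have e1 : y (k + 1) - (G (xb k) - y k - (G (xb k) - y (k + 1))) = y k := by abel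
        have e2 : xs + (x (k + 1) - xs) = x (k + 1) := by abel
        have e3 : xs - x (k + 1) = -(x (k + 1) - xs) := by abel
        rw [e1, e2]
        rw [e3] at h
        simp only [map_neg] at h
        linarith)
      (by
        have h := hco _ (hxbV (k + 1)) _ hxsV
        have e3 : xs - xb (k + 1) = -(xb (k + 1) - xs) := by abel
        rw [← hy, e3, map_neg] at h
        have := hsq (G xs - y (k + 1))
        linarith)
      (by
        have h := hco _ (hxbV (k + 1)) _ (hxbV k)
        rw [← hy] at h
        have e3 : xb k - xs - (xb (k + 1) - xs) = xb k - xb (k + 1) := by abel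
        rwa [e3])
    have e4 : G (xb k) - y k - (G (xb k) - y (k + 1)) = y (k + 1) - y k := by abel
    have e5 : x (k + 1) - xs - (x (k + 1) - x k) = x k - xs := by abel
    rw [e4, e5] at h
    simp only [hΦ, hδ k]
    exact h
  have hβ : 0 < 1 / ((1 + s) * μ) := by positivity
  -- Completing the square in `δ k` costs half of the quadratic term of the potential, and
  -- cocoercivity at `xs` makes the function gap nonnegative.
  have hlow : (1 + s) / 4 * Q (x k - xs) (x k - xs) ≤ Φ k := by
    have h1 := hB0 (δ k - ((1 + s) * μ / 2) • (x k - xs))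
    have h2 := hQμ (x k - xs)
    have h3 : 0 ≤ f (xb k) - f xs - B (G xs) (xb k - xs) := by
      have := hco _ hxsV _ (hxbV k)
      have := hsq (G (xb k) - G xs)
      linarith
    have h5 : 1 / ((1 + s) * μ) * B (δ k - ((1 + s) * μ / 2) • (x k - xs))
        (δ k - ((1 + s) * μ / 2) • (x k - xs)) = 1 / ((1 + s) * μ) * B (δ k) (δ k)
          - B (δ k) (x k - xs) + (1 + s) / 4 * (μ * B (x k - xs) (x k - xs)) := by
      generalize x k - xs = v
      simp only [map_sub, map_smul, LinearMap.sub_apply, LinearMap.smul_apply, smul_eq_mul,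
        hB v (δ k)]
      field_simp
      ring
    have h4 := mul_nonneg hs1.le h3
    have h6 := mul_nonneg hβ.le h1
    have h7 := mul_le_mul_of_nonneg_left h2 (show 0 ≤ (1 + s) / 4 by linarith)
    rw [h5] at h6
    simp only [hΦ]
    linarith
  have hup : ∀ k, Φ k ≤ (s / (1 + s)) ^ k *
      ((1 + s) / 2 * Q (x 0 - xs) (x 0 - xs)
        + (1 + s) * (f (xb 0) - f xs - B (G xs) (xb 0 - xs))
        + 2 / (s * μ) * B (G (xb 0)) (G (xb 0))) := by
    have hG := hB0 (G (xb 0))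
    intro k
    rcases k with _ | k
    · have : 0 ≤ 2 / (s * μ) * B (G (xb 0)) (G (xb 0)) := mul_nonneg (by positivity) hG
      simp only [hΦ, hδ0, map_zero, LinearMap.zero_apply, pow_zero]
      linarith
    · induction k with
      | zero =>
        have h := hstep 0
        -- The first dual iterate is `0` and not the gradient at the starting point, so the first
        -- step leaves an error term. It is charged to the initial constant, divided by the
        -- contraction factor.
        have e : s / (1 + s) * (2 / (s * μ)) = 2 / ((1 + s) * μ) := by field_simp
        rw [hy0, sub_zero, ← e] at h
        simp only [hΦ, hδ0, map_zero, LinearMap.zero_apply] at h ⊢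
        rw [zero_add, pow_one]
        linarith
      | succ k ih =>
        have h := hstep (k + 1)
        -- From the second step on, the dual iterate is the gradient at the extrapolation point, so
        -- there is no error term.
        rw [← hy, sub_self, map_zero, mul_zero, add_zero] at h
        rw [pow_succ', mul_assoc]
        exact h.trans (mul_le_mul_of_nonneg_left ih (by positivity))
  exact hlow.trans (hup k)

end Rate

/-- Comparison of the geometric sums with ratios `b` and `b ^ 2`. -/
theorem pow_mul_geom_le {b : ℝ} (hb : 1 ≤ b) {s S : ℕ → ℝ} (hs0 : s 0 = 0) (hS0 : S 0 = 0)
    (hs : ∀ k, s (k + 1) = s k + b ^ (k + 1)) (hS : ∀ k, S (k + 1) = S k + (b ^ 2) ^ (k + 1))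
    (k : ℕ) : b ^ k * s k ≤ 2 * S k := by
  have hS' : ∀ k, (b ^ 2 - 1) * S k = (b ^ 2) ^ (k + 1) - b ^ 2 := by
    intro k
    induction k with
    | zero => simp [hS0]
    | succ k ih => rw [hS, mul_add, ih]; ring
  have hS1 : ∀ k, 0 ≤ S k := by
    intro k
    induction k with
    | zero => simp [hS0]
    | succ k ih => rw [hS]; positivity
  induction k with
  | zero => simp [hs0, hS0]
  | succ k ih =>
    rw [hs, hS]
    have h1 : b ^ (k + 1) * (s k + b ^ (k + 1)) = b * (b ^ k * s k) + (b ^ 2) ^ (k + 1) := by ring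
    have h2 := mul_le_mul_of_nonneg_left ih (show 0 ≤ b by linarith)
    -- Together with the telescoped identity for `(b ^ 2 - 1) * S k` this pays for the growth factor
    -- `b`; avoiding division by `b - 1` keeps the constant `2` uniform in `b`.
    have h3 : 2 * (b - 1) * S k ≤ (b ^ 2 - 1) * S k :=
      mul_le_mul_of_nonneg_right (by nlinarith) (hS1 k)
    have h4 := hS' k
    have h5 : 0 ≤ b ^ 2 := by positivity
    rw [h1]
    linarith

/-! ### Norms, the Euclidean structure of the dual variables, and existence of minimisers. -/

variable {n : ℕ}

theorem minEntry_le (a : Fin n → ℝ) (i : Fin n) : minEntry a ≤ a i :=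
  ciInf_le (Set.finite_range a).bddBelow i

theorem le_normInf (C : Mat n) (i j : Fin n) : C i j ≤ normInf C :=
  (le_abs_self _).trans <| (le_ciSup (Set.finite_range fun j => |C i j|).bddAbove j).trans <|
    le_ciSup (f := fun i => ⨆ j, |C i j|) (Set.finite_range _).bddAbove i

theorem normInf_pos {C : Mat n} (hC : ∀ i j, 0 ≤ C i j) (h : C ≠ 0) : 0 < normInf C := by
  by_contra hn
  push Not at hn
  exact h (funext fun i => funext fun j => le_antisymm ((le_normInf C i j).trans hn) (hC i j))

theorem normInf_nonneg (C : Mat n) : 0 ≤ normInf C :=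
  Real.iSup_nonneg fun _ => Real.iSup_nonneg fun _ => abs_nonneg _

/-- The Euclidean inner product as a bilinear form. -/
def dotB (n : ℕ) : LinearMap.BilinForm ℝ (Var n) :=
  LinearMap.mk₂ ℝ dot
    (fun x y z => by simp [dot, add_mul, Finset.sum_add_distrib]; ring)
    (fun c x z => by simp [dot, mul_add, Finset.mul_sum, mul_assoc])
    (fun x y z => by simp [dot, mul_add, Finset.sum_add_distrib]; ring)
    (fun c x z => by simp [dot, mul_add, Finset.mul_sum, mul_left_comm])

theorem dotB_apply (x y : Var n) : dotB n x y = dot x y := rfl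

theorem dot_comm (x y : Var n) : dot x y = dot y x := by
  simp only [dot, mul_comm]

theorem dot_self_nonneg (x : Var n) : 0 ≤ dot x x := by
  unfold dot
  exact add_nonneg (add_nonneg (Finset.sum_nonneg fun i _ => mul_self_nonneg _)
    (Finset.sum_nonneg fun i _ => mul_self_nonneg _))
    (Finset.sum_nonneg fun i _ => Finset.sum_nonneg fun j _ => mul_self_nonneg _)

theorem continuous_dot (g : Var n) : Continuous fun z : Var n => dot g z := by
  unfold dot; fun_prop

/-- Coordinates are bounded by the squared length. -/
theorem mem_Icc_of_dot_self_le {x : Var n} {R : ℝ} (h : dot x x ≤ R) :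
    x ∈ Icc ((fun _ => -(R + 1), fun _ => -(R + 1), fun _ _ => -(R + 1)) : Var n)
      (fun _ => R + 1, fun _ => R + 1, fun _ _ => R + 1) := by
  have key : ∀ r : ℝ, r * r ≤ R → -(R + 1) ≤ r ∧ r ≤ R + 1 := fun r hr =>
    ⟨by nlinarith, by nlinarith⟩
  have n1 : 0 ≤ ∑ i, x.1 i * x.1 i := Finset.sum_nonneg fun i _ => mul_self_nonneg _
  have n2 : 0 ≤ ∑ i, x.2.1 i * x.2.1 i := Finset.sum_nonneg fun i _ => mul_self_nonneg _
  have n3' : ∀ i, 0 ≤ ∑ j, x.2.2 i j * x.2.2 i j :=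
    fun i => Finset.sum_nonneg fun j _ => mul_self_nonneg _
  have n3 : 0 ≤ ∑ i, ∑ j, x.2.2 i j * x.2.2 i j := Finset.sum_nonneg fun i _ => n3' i
  unfold dot at h
  have k1 : ∀ i, -(R + 1) ≤ x.1 i ∧ x.1 i ≤ R + 1 := fun i => key _ <| by
    have := Finset.single_le_sum (f := fun i => x.1 i * x.1 i)
      (fun i _ => mul_self_nonneg _) (Finset.mem_univ i)
    linarith
  have k2 : ∀ i, -(R + 1) ≤ x.2.1 i ∧ x.2.1 i ≤ R + 1 := fun i => key _ <| by
    have := Finset.single_le_sum (f := fun i => x.2.1 i * x.2.1 i)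
      (fun i _ => mul_self_nonneg _) (Finset.mem_univ i)
    linarith
  have k3 : ∀ i j, -(R + 1) ≤ x.2.2 i j ∧ x.2.2 i j ≤ R + 1 := fun i j => key _ <| by
    have h1 := Finset.single_le_sum (f := fun j => x.2.2 i j * x.2.2 i j)
      (fun j _ => mul_self_nonneg _) (Finset.mem_univ j)
    have h2 := Finset.single_le_sum (f := fun i => ∑ j, x.2.2 i j * x.2.2 i j)
      (fun i _ => n3' i) (Finset.mem_univ i)
    linarith
  exact ⟨⟨fun i => (k1 i).1, fun i => (k2 i).1, fun i j => (k3 i j).1⟩,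
    ⟨fun i => (k1 i).2, fun i => (k2 i).2, fun i j => (k3 i j).2⟩⟩

/-- A continuous function on a closed set with an order-bounded sublevel set has a minimiser. -/
theorem exists_isMinOn_of_sublevel_bounded {X : Type*} [Preorder X] [TopologicalSpace X]
    [CompactIccSpace X] {S : Set X} (hS : IsClosed S) {F : X → ℝ} (hF : Continuous F) {x₀ lo hi : X}
    (hx₀ : x₀ ∈ S) (h : ∀ z ∈ S, F z ≤ F x₀ → z ∈ Icc lo hi) : ∃ x ∈ S, IsMinOn F S x := by
  have hK : IsCompact (Icc lo hi ∩ (S ∩ {z | F z ≤ F x₀})) :=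
    isCompact_Icc.inter_right (hS.inter (isClosed_le hF continuous_const))
  obtain ⟨x, hx, hmin⟩ := hK.exists_isMinOn ⟨x₀, h x₀ hx₀ le_rfl, hx₀, le_refl (F x₀)⟩ hF.continuousOn
  refine ⟨x, hx.2.1, fun z hz => ?_⟩
  by_cases hzx : F z ≤ F x₀
  · exact hmin ⟨h z hz hzx, hz, hzx⟩
  · exact hx.2.2.trans (not_le.1 hzx).le

/-! ### Admissible problems: the quadratic form of `w` and the proximal subproblem. -/

namespace UOT

variable {P : UOT n}

/-- The regularised problem has a nonnegative cost, positive parameters, and positive marginals of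
total mass one. -/
structure Admissible (P : UOT n) : Prop where
  C_nonneg : ∀ i j, 0 ≤ P.C i j
  a_mem : P.a ∈ simplex n
  b_mem : P.b ∈ simplex n
  a_pos : 0 < minEntry P.a
  b_pos : 0 < minEntry P.b
  τ_pos : 0 < P.τ
  η_pos : 0 < P.η

theorem low_le_a (P : UOT n) (i : Fin n) : P.low ≤ P.a i := (min_le_left _ _).trans (minEntry_le _ _)

theorem low_le_b (P : UOT n) (j : Fin n) : P.low ≤ P.b j := (min_le_right _ _).trans (minEntry_le _ _)

theorem isClosed_feasible (P : UOT n) : IsClosed P.feasible := by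
  simp only [feasible, ofPred_and, ofPred_forall]
  refine isClosed_iInter fun i => isClosed_iInter fun j =>
    (isClosed_le (by fun_prop) (by fun_prop)).inter (isClosed_le (by fun_prop) (by fun_prop))

theorem isClosed_box (P : UOT n) : IsClosed P.box := by
  simp only [box, ofPred_and, ofPred_forall]
  refine (isClosed_iInter fun i => ?_).inter (isClosed_iInter fun i => ?_) <;>
  exact (isClosed_le (by fun_prop) (by fun_prop)).inter (isClosed_le (by fun_prop) (by fun_prop))

theorem convex_domain (P : UOT n) : Convex ℝ (P.box ∩ P.feasible) := by
  have comb : ∀ {lo hi x y r s : ℝ}, 0 ≤ r → 0 ≤ s → r + s = 1 → lo ≤ x ∧ x ≤ hi →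
      lo ≤ y ∧ y ≤ hi → lo ≤ r * x + s * y ∧ r * x + s * y ≤ hi := by
    intro lo hi x y r s hr hs hrs hx hy
    obtain rfl : s = 1 - r := by linarith
    constructor <;> nlinarith
  intro x hx y hy r s hr hs hrs
  refine ⟨⟨fun i => comb hr hs hrs (hx.1.1 i) (hy.1.1 i),
    fun j => comb hr hs hrs (hx.1.2 j) (hy.1.2 j)⟩, fun i j => ?_⟩
  have h1 := hx.2 i j
  have h2 := hy.2 i j
  simp only [Prod.fst_add, Prod.snd_add, Prod.smul_fst, Prod.smul_snd, Pi.add_apply, Pi.smul_apply,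
    smul_eq_mul]
  have e1 := mul_nonneg hr h1.1
  have e2 := mul_nonneg hs h2.1
  have e3 := mul_le_mul_of_nonneg_left h1.2 hr
  have e4 := mul_le_mul_of_nonneg_left h2.2 hs
  have e5 : P.C i j = r * P.C i j + s * P.C i j := by rw [← add_mul, hrs, one_mul]
  constructor <;> linarith

/-- The Hessian of `w` as a bilinear form. -/
def hess (P : UOT n) : LinearMap.BilinForm ℝ (Var n) :=
  LinearMap.mk₂ ℝ (fun x y => dot (P.gradW x) y)
    (fun x y z => by simp [dot, gradW, mul_add, add_mul, Finset.sum_add_distrib]; ring)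
    (fun c x z => by simp [dot, gradW, mul_add, Finset.mul_sum, mul_left_comm, mul_assoc])
    (fun x y z => by simp [dot, mul_add, Finset.sum_add_distrib]; ring)
    (fun c x z => by simp [dot, mul_add, Finset.mul_sum, mul_left_comm])

theorem hess_apply (P : UOT n) (x y : Var n) : P.hess x y = dot (P.gradW x) y := rfl

theorem hess_comm (P : UOT n) (x y : Var n) : P.hess x y = P.hess y x := by
  simp only [hess_apply, dot, gradW]
  congr 1
  · congr 1 <;> exact Finset.sum_congr rfl fun i _ => by ring
  · exact Finset.sum_congr rfl fun i _ => Finset.sum_congr rfl fun j _ => by ring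

theorem hess_self (P : UOT n) (x : Var n) : P.hess x x =
    P.modulus * (∑ i, x.1 i ^ 2 + ∑ j, x.2.1 j ^ 2)
      + 1 / (2 * P.η) * ∑ i, ∑ j, x.2.2 i j ^ 2 := by
  simp only [hess_apply, dot, gradW, mul_add, Finset.mul_sum]
  congr 1
  · congr 1 <;> exact Finset.sum_congr rfl fun i _ => by ring
  · exact Finset.sum_congr rfl fun i _ => Finset.sum_congr rfl fun j _ => by ring

theorem w_eq (P : UOT n) (x : Var n) : P.w x = P.hess x x / 2 := by
  rw [hess_self, w]
  by_cases h : P.η = 0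
  · simp [h]; ring
  · field_simp; ring

/-- Since `w` is a pure quadratic, its Bregman distance is its own value at the difference; this
makes the abstract rate with a bilinear form applicable. -/
theorem bregman_eq (P : UOT n) (x₀ x : Var n) :
    P.bregman x₀ x = P.hess (x - x₀) (x - x₀) / 2 / P.mu := by
  rw [bregman, w_eq, w_eq, ← hess_apply]
  congr 1
  simp only [map_sub, LinearMap.sub_apply, P.hess_comm x x₀]
  ring

theorem mu_mul_dot_le (P : UOT n) (x : Var n) : P.mu * dot x x ≤ P.hess x x := by
  rw [hess_self]
  have h1 : P.mu ≤ P.modulus := min_le_left _ _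
  have h2 : P.mu ≤ 1 / (2 * P.η) := min_le_right _ _
  have e : dot x x = (∑ i, x.1 i ^ 2 + ∑ j, x.2.1 j ^ 2) + ∑ i, ∑ j, x.2.2 i j ^ 2 := by
    simp only [dot, sq]
  rw [e, mul_add]
  exact add_le_add (mul_le_mul_of_nonneg_right h1 (by positivity))
    (mul_le_mul_of_nonneg_right h2 (by positivity))

namespace Admissible

theorem n_pos (hP : P.Admissible) : 0 < n := by
  rcases Nat.eq_zero_or_pos n with rfl | h
  · simpa using hP.a_mem.2
  · exact h

theorem low_pos (hP : P.Admissible) : 0 < P.low := lt_min hP.a_pos hP.b_pos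

theorem a_pos' (hP : P.Admissible) (i : Fin n) : 0 < P.a i := hP.low_pos.trans_le (P.low_le_a i)

theorem b_pos' (hP : P.Admissible) (i : Fin n) : 0 < P.b i := hP.low_pos.trans_le (P.low_le_b i)

theorem a_le_one (hP : P.Admissible) (i : Fin n) : P.a i ≤ 1 :=
  (Finset.single_le_sum (fun i _ => hP.a_mem.1 i) (Finset.mem_univ i)).trans_eq hP.a_mem.2

theorem b_le_one (hP : P.Admissible) (i : Fin n) : P.b i ≤ 1 :=
  (Finset.single_le_sum (fun i _ => hP.b_mem.1 i) (Finset.mem_univ i)).trans_eq hP.b_mem.2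

theorem low_le_one (hP : P.Admissible) : P.low ≤ 1 :=
  (P.low_le_a ⟨0, hP.n_pos⟩).trans (hP.a_le_one _)

theorem mass_eq (hP : P.Admissible) : P.mass = 2 := by
  rw [mass, hP.a_mem.2, hP.b_mem.2]; norm_num

theorem log_low (hP : P.Admissible) :
    Real.log P.low = min (Real.log (minEntry P.a)) (Real.log (minEntry P.b)) := by
  rw [low]
  rcases le_total (minEntry P.a) (minEntry P.b) with h | h
  · rw [min_eq_left h, min_eq_left (Real.log_le_log hP.a_pos h)]
  · rw [min_eq_right h, min_eq_right (Real.log_le_log hP.b_pos h)]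

theorem D_eq (hP : P.Admissible) :
    P.D = normInf P.C + 2 * P.η - P.τ * Real.log P.low := by
  rw [D, hP.mass_eq, hP.log_low]; norm_num; ring

theorem neg_D_div (hP : P.Admissible) :
    -(P.D / P.τ) = Real.log P.low - (normInf P.C + 2 * P.η) / P.τ := by
  have := hP.τ_pos
  rw [hP.D_eq]; field_simp; ring

/-- `D` contains `-τ log low`, so its exponential contributes a second factor `low` to the modulus.
This is why `1 / μ` grows like `κ²`. -/
theorem exp_neg_D (hP : P.Admissible) :
    Real.exp (-(P.D / P.τ)) = P.low * Real.exp (-((normInf P.C + 2 * P.η) / P.τ)) := by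
  rw [hP.neg_D_div, sub_eq_add_neg, Real.exp_add, Real.exp_log hP.low_pos]

theorem modulus_pos (hP : P.Admissible) : 0 < P.modulus :=
  mul_pos (div_pos hP.low_pos hP.τ_pos) (Real.exp_pos _)

theorem mu_pos (hP : P.Admissible) : 0 < P.mu :=
  lt_min hP.modulus_pos (by have := hP.η_pos; positivity)

theorem L_pos (hP : P.Admissible) : 0 < P.L := by
  have h1 := hP.modulus_pos
  have h2 := hP.τ_pos
  rw [L, hP.mass_eq]; positivity

theorem log_low_nonpos (hP : P.Admissible) : Real.log P.low ≤ 0 :=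
  Real.log_nonpos hP.low_pos.le hP.low_le_one

theorem le_D (hP : P.Admissible) : normInf P.C + 2 * P.η ≤ P.D := by
  rw [hP.D_eq]
  have := mul_nonneg hP.τ_pos.le (neg_nonneg.2 hP.log_low_nonpos)
  linarith

theorem D_nonneg (hP : P.Admissible) : 0 ≤ P.D :=
  (add_nonneg (normInf_nonneg _) (by have := hP.η_pos; positivity)).trans hP.le_D

theorem mem_box_iff (hP : P.Admissible) (x : Var n) : x ∈ P.box ↔
    (∀ i, P.τ * Real.log (P.a i) ≤ x.1 i ∧ x.1 i ≤ P.D) ∧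
      (∀ j, P.τ * Real.log (P.b j) ≤ x.2.1 j ∧ x.2.1 j ≤ P.D) := by
  have h : ∀ r : ℝ, 2 * r / 2 = r := fun r => by ring
  simp only [box, hP.mass_eq, h, mem_ofPred_eq]

theorem zero_mem_feasible (hP : P.Admissible) : (0 : Var n) ∈ P.feasible := fun i j => by
  simpa using hP.C_nonneg i j

theorem zero_mem_box (hP : P.Admissible) : (0 : Var n) ∈ P.box := by
  rw [hP.mem_box_iff]
  exact ⟨fun i => ⟨mul_nonpos_of_nonneg_of_nonpos hP.τ_pos.le
    (Real.log_nonpos (hP.a_pos' i).le (hP.a_le_one i)), hP.D_nonneg⟩,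
    fun i => ⟨mul_nonpos_of_nonneg_of_nonpos hP.τ_pos.le
    (Real.log_nonpos (hP.b_pos' i).le (hP.b_le_one i)), hP.D_nonneg⟩⟩

theorem hess_self_nonneg (hP : P.Admissible) (x : Var n) : 0 ≤ P.hess x x :=
  (mul_nonneg hP.mu_pos.le (dot_self_nonneg x)).trans (P.mu_mul_dot_le x)

/-- The proximal subproblem is solvable. -/
theorem isProx_prox (hP : P.Admissible) (g x₀ : Var n) {θ : ℝ} (hθ : 0 ≤ θ) :
    P.IsProx g x₀ θ (P.prox g x₀ θ) := by
  have hμ := hP.mu_pos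
  refine Classical.epsilon_spec (p := P.IsProx g x₀ θ) ?_
  set F : Var n → ℝ := fun z => dot g z + P.w z + θ * P.bregman x₀ z with hF
  have hcont : Continuous F := by
    have hw : Continuous P.w := by unfold w; fun_prop
    have hb : Continuous (P.bregman x₀) := by
      unfold bregman
      exact (hw.sub (continuous_const.add ((continuous_dot _).comp
        (continuous_id.sub continuous_const)))).div_const _
    exact ((continuous_dot g).add hw).add (continuous_const.mul hb)
  obtain ⟨x, hx, hmin⟩ := exists_isMinOn_of_sublevel_bounded
    (P.isClosed_box.inter P.isClosed_feasible) hcont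
    (x₀ := 0) ⟨hP.zero_mem_box, hP.zero_mem_feasible⟩ fun z _ hz =>
      mem_Icc_of_dot_self_le (R := 4 / P.mu * (F 0 + 1 / P.mu * dot g g)) (by
        -- Coercivity: the linear term is absorbed into half of the strongly convex part, and the
        -- Bregman term is nonnegative. This yields the radius `R` above.
        have h1 := dot_self_nonneg (g + (P.mu / 2) • z)
        have h2 := P.mu_mul_dot_le z
        have h3 : 0 ≤ θ * P.bregman x₀ z := by
          rw [bregman_eq]
          have := hP.hess_self_nonneg (z - x₀)
          positivity
        have h4 : dot g z + P.mu / 2 * dot z z ≤ F 0 := by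
          have : F z = dot g z + P.w z + θ * P.bregman x₀ z := rfl
          rw [w_eq] at this
          linarith
        rw [← dotB_apply] at h1
        simp only [map_add, map_smul, LinearMap.add_apply, LinearMap.smul_apply, dotB_apply,
          smul_eq_mul, dot_comm z g] at h1
        rw [div_mul_eq_mul_div, le_div_iff₀ hμ]
        have h5 : 1 / P.mu * (dot g g + P.mu / 2 * dot g z + P.mu / 2 * (dot g z + P.mu / 2 * dot z z))
          = 1 / P.mu * dot g g + dot g z + P.mu / 4 * dot z z := by field_simp; ring
        have h6 := mul_nonneg (show 0 ≤ 1 / P.mu by positivity) h1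
        rw [h5] at h6
        linarith)
  exact ⟨x, hx, hmin⟩

/-- Variational inequality of the proximal subproblem. -/
theorem isProx_variational (hP : P.Admissible) {g x₀ x : Var n} {θ : ℝ}
    (h : P.IsProx g x₀ θ x) {z : Var n} (hz : z ∈ P.box ∩ P.feasible) :
    0 ≤ dot g (z - x) + P.hess x (z - x) + θ / P.mu * P.hess (x - x₀) (z - x) := by
  have hμ := hP.mu_pos
  -- Along the segment from `x` to `z` the objective is exactly quadratic in `r`; this is its
  -- second-order coefficient.
  refine nonneg_of_forall_quadratic (B := (1 + θ / P.mu) * P.hess (z - x) (z - x) / 2)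
    fun r hr0 hr1 => ?_
  have hm : x + r • (z - x) ∈ P.box ∩ P.feasible :=
    P.convex_domain.add_smul_sub_mem h.1 hz ⟨hr0, hr1⟩
  have h1 := h.2 hm
  simp only [mem_ofPred_eq, w_eq, bregman_eq, ← dotB_apply] at h1
  have e : x + r • (z - x) - x₀ = (x - x₀) + r • (z - x) := by abel
  rw [e] at h1
  rw [← dotB_apply]
  generalize z - x = v at *
  generalize x - x₀ = d at *
  simp only [map_add, map_smul, LinearMap.add_apply, LinearMap.smul_apply, smul_eq_mul,
    P.hess_comm v x, P.hess_comm v d] at h1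
  have e2 : ∀ A : ℝ, θ * (A / 2 / P.mu) = θ / P.mu * A / 2 := fun A => by ring
  rw [e2, e2] at h1
  linarith

end Admissible

end UOT

/-! ### Dual solutions: existence, optimality conditions and a priori bounds. -/

namespace UOT

variable {P : UOT n}

/-- The penalised row sums and column sums, and complementary slackness, of a dual solution. -/
structure IsKKT (P : UOT n) (x : Var n) : Prop where
  feasible : x ∈ P.feasible
  row : ∀ i, 1 / (2 * P.η) * ∑ j, x.2.2 i j = P.a i * Real.exp (-(x.1 i / P.τ))
  col : ∀ j, 1 / (2 * P.η) * ∑ i, x.2.2 i j = P.b j * Real.exp (-(x.2.1 j / P.τ))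
  slack : ∀ i j, 0 < x.2.2 i j → x.2.2 i j = x.1 i + x.2.1 j - P.C i j

namespace Admissible

/-- The dual problem has a solution. -/
theorem exists_isDualSolution (hP : P.Admissible) : ∃ x, P.IsDualSolution x := by
  have hτ := hP.τ_pos
  have hη := hP.η_pos
  have hlow := hP.low_pos
  have hcont : Continuous P.h := by unfold h; fun_prop
  obtain ⟨i₀⟩ : Nonempty (Fin n) := ⟨⟨0, hP.n_pos⟩⟩
  -- On the sublevel set of the point `0`, each summand of `h` is at most `h 0`. The quadratic part
  -- bounds `t` by `T`, the exponentials bound the potentials below by `-B`, and the constraint `u_i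
  -- + v_j - C_ij ≤ t_ij` then bounds them above.
  set T := 4 * P.η * P.h 0 + 1
  set B := P.h 0 / P.low
  set N := normInf P.C
  refine exists_isMinOn_of_sublevel_bounded P.isClosed_feasible hcont hP.zero_mem_feasible
    (lo := (fun _ => -B, fun _ => -B, fun _ _ => 0))
    (hi := (fun _ => N + T + B, fun _ => N + T + B, fun _ _ => T)) fun z hz hle => ?_
  have ha : ∀ i, 0 ≤ Real.exp (-(z.1 i / P.τ)) * P.a i :=
    fun i => mul_nonneg (Real.exp_pos _).le (hP.a_pos' i).le
  have hb : ∀ j, 0 ≤ Real.exp (-(z.2.1 j / P.τ)) * P.b j :=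
    fun j => mul_nonneg (Real.exp_pos _).le (hP.b_pos' j).le
  have h1 : 0 ≤ 1 / (4 * P.η) * ∑ i, ∑ j, z.2.2 i j ^ 2 := by positivity
  have h2 : 0 ≤ P.τ * ∑ i, Real.exp (-(z.1 i / P.τ)) * P.a i :=
    mul_nonneg hτ.le (Finset.sum_nonneg fun i _ => ha i)
  have h3 : 0 ≤ P.τ * ∑ j, Real.exp (-(z.2.1 j / P.τ)) * P.b j :=
    mul_nonneg hτ.le (Finset.sum_nonneg fun i _ => hb i)
  have hz' : P.h z = 1 / (4 * P.η) * ∑ i, ∑ j, z.2.2 i j ^ 2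
    + P.τ * ∑ i, Real.exp (-(z.1 i / P.τ)) * P.a i
    + P.τ * ∑ j, Real.exp (-(z.2.1 j / P.τ)) * P.b j := rfl
  have lower : ∀ {r p : ℝ}, P.low ≤ p → P.τ * (Real.exp (-(r / P.τ)) * p) ≤ P.h 0 → -B ≤ r := by
    intro r p hp h
    have e1 : -(r / P.τ) ≤ Real.exp (-(r / P.τ)) := by
      have := Real.add_one_le_exp (-(r / P.τ)); linarith
    have e2 : P.τ * (Real.exp (-(r / P.τ)) * P.low) ≤ P.h 0 :=
      (mul_le_mul_of_nonneg_left (mul_le_mul_of_nonneg_left hp (Real.exp_pos _).le) hτ.le).trans h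
    have e3 : P.τ * (-(r / P.τ) * P.low) ≤ P.h 0 :=
      (mul_le_mul_of_nonneg_left (mul_le_mul_of_nonneg_right e1 hlow.le) hτ.le).trans e2
    have e4 : P.τ * (-(r / P.τ) * P.low) = -r * P.low := by field_simp
    rw [e4] at e3
    have : -r ≤ P.h 0 / P.low := (le_div_iff₀ hlow).2 e3
    linarith
  have k1 : ∀ i, -B ≤ z.1 i := fun i => lower (P.low_le_a i) <| by
    have := mul_le_mul_of_nonneg_left
      (Finset.single_le_sum (fun i _ => ha i) (Finset.mem_univ i)) hτ.le
    linarith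
  have k2 : ∀ j, -B ≤ z.2.1 j := fun i => lower (P.low_le_b i) <| by
    have := mul_le_mul_of_nonneg_left
      (Finset.single_le_sum (fun i _ => hb i) (Finset.mem_univ i)) hτ.le
    linarith
  have k3 : ∀ i j, z.2.2 i j ≤ T := fun i j => by
    have e1 : z.2.2 i j ^ 2 ≤ ∑ i, ∑ j, z.2.2 i j ^ 2 :=
      (Finset.single_le_sum (f := fun j => z.2.2 i j ^ 2) (fun j _ => sq_nonneg _)
        (Finset.mem_univ j)).trans
      (Finset.single_le_sum (f := fun i => ∑ j, z.2.2 i j ^ 2)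
        (fun i _ => Finset.sum_nonneg fun j _ => sq_nonneg _) (Finset.mem_univ i))
    have e2 : 1 / (4 * P.η) * z.2.2 i j ^ 2 ≤ P.h 0 :=
      (mul_le_mul_of_nonneg_left e1 (by positivity)).trans (by linarith)
    rw [one_div_mul_eq_div, div_le_iff₀ (by positivity)] at e2
    nlinarith
  refine ⟨⟨k1, k2, fun i j => (hz i j).1⟩, ⟨fun i => ?_, fun j => ?_, k3⟩⟩
  · have := (hz i i₀).2
    have := k3 i i₀
    have := k2 i₀
    have := le_normInf P.C i i₀
    show z.1 i ≤ N + T + B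
    linarith
  · have := (hz i₀ j).2
    have := k3 i₀ j
    have := k1 i₀
    have := le_normInf P.C i₀ j
    show z.2.1 j ≤ N + T + B
    linarith

/-- First-order stationarity of a dual solution in the potentials. -/
theorem stationary (hP : P.Admissible) {x : Var n} (hx : P.IsDualSolution x) (d e : Fin n → ℝ) :
    1 / (2 * P.η) * ∑ i, ∑ j, x.2.2 i j * (d i + e j)
      = ∑ i, P.a i * Real.exp (-(x.1 i / P.τ)) * d i
        + ∑ j, P.b j * Real.exp (-(x.2.1 j / P.τ)) * e j := by
  have hτ := hP.τ_pos
  have hη := hP.η_pos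
  -- Moving `t` along with the potentials preserves the second constraint but may make entries
  -- negative. Truncating at `0` restores feasibility without increasing the squares, so `φ`, left
  -- untruncated and hence smooth, still has a two-sided minimum at `0`.
  set φ : ℝ → ℝ := fun s => 1 / (4 * P.η) * ∑ i, ∑ j, (x.2.2 i j + s * (d i + e j)) ^ 2
    + P.τ * ∑ i, Real.exp (-((x.1 i + s * d i) / P.τ)) * P.a i
    + P.τ * ∑ j, Real.exp (-((x.2.1 j + s * e j) / P.τ)) * P.b j with hφ
  have hmin : ∀ s, φ 0 ≤ φ s := by
    intro s
    have h0 : φ 0 = P.h x := by simp [hφ, h]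
    have hmem : ((fun i => x.1 i + s * d i, fun j => x.2.1 j + s * e j,
        fun i j => max 0 (x.2.2 i j + s * (d i + e j))) : Var n) ∈ P.feasible := fun i j => by
      have := (hx.1 i j).2
      exact ⟨le_max_left _ _, le_max_of_le_right (by simp only; linarith)⟩
    rw [h0]
    refine (hx.2 hmem).trans ?_
    simp only [h, hφ]
    gcongr 1 / (4 * P.η) * (∑ i, ∑ j, ?_) + _ + _ with i _ j _
    rw [sq_le_sq, abs_of_nonneg (le_max_left _ _)]
    exact max_le (abs_nonneg _) (le_abs_self _)
  have hexp : ∀ c p q : ℝ, HasDerivAt (fun s : ℝ => Real.exp (-((c + s * p) / P.τ)) * q)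
      (-(q * Real.exp (-(c / P.τ)) * p) / P.τ) 0 := by
    intro c p q
    have h1 : HasDerivAt (fun s : ℝ => -((c + s * p) / P.τ)) (-(p / P.τ)) 0 := by
      simpa using ((((hasDerivAt_id (0 : ℝ)).mul_const p).const_add c).div_const P.τ).fun_neg
    refine (h1.exp.mul_const q).congr_deriv ?_
    simp only [zero_mul, add_zero]
    ring
  have hsq : ∀ c p : ℝ, HasDerivAt (fun s : ℝ => (c + s * p) ^ 2) (2 * c * p) 0 := by
    intro c p
    have h1 : HasDerivAt (fun s : ℝ => c + s * p) p 0 := by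
      simpa using ((hasDerivAt_id (0 : ℝ)).mul_const p).const_add c
    simpa using h1.fun_pow 2
  have hd : HasDerivAt φ (1 / (4 * P.η) * ∑ i, ∑ j, 2 * x.2.2 i j * (d i + e j)
      + P.τ * ∑ i, -(P.a i * Real.exp (-(x.1 i / P.τ)) * d i) / P.τ
      + P.τ * ∑ j, -(P.b j * Real.exp (-(x.2.1 j / P.τ)) * e j) / P.τ) 0 :=
    (((HasDerivAt.fun_sum fun i _ => HasDerivAt.fun_sum fun j _ => hsq _ _).const_mul _).add
      ((HasDerivAt.fun_sum fun i _ => hexp _ _ _).const_mul _)).add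
      ((HasDerivAt.fun_sum fun j _ => hexp _ _ _).const_mul _)
  have hz := (show IsLocalMin φ 0 from Filter.Eventually.of_forall hmin).hasDerivAt_eq_zero hd
  have e1 : 1 / (4 * P.η) * ∑ i, ∑ j, 2 * x.2.2 i j * (d i + e j)
      = 1 / (2 * P.η) * ∑ i, ∑ j, x.2.2 i j * (d i + e j) := by
    simp only [mul_assoc, ← Finset.mul_sum]
    field_simp
    norm_num
  rw [e1, ← Finset.sum_div, ← Finset.sum_div, mul_div_cancel₀ _ hτ.ne', mul_div_cancel₀ _ hτ.ne',
    Finset.sum_neg_distrib, Finset.sum_neg_distrib] at hz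
  linarith

/-- The marginal equations are stationarity in single coordinates of `u` and `v`. For slackness,
replacing `t` by the smallest feasible `max 0 (u_i + v_j - C_ij)` would strictly decrease `h` if
some positive entry exceeded its lower bound. -/
theorem isKKT (hP : P.Admissible) {x : Var n} (hx : P.IsDualSolution x) : P.IsKKT x where
  feasible := hx.1
  row i := by
    have := hP.stationary hx (Pi.single i 1) 0
    simpa [Pi.single_apply] using this
  col j := by
    have := hP.stationary hx 0 (Pi.single j 1)
    simpa [Pi.single_apply] using this
  slack i j hij := by
    have hη := hP.η_pos
    by_contra hne
    have hlt : x.1 i + x.2.1 j - P.C i j < x.2.2 i j := lt_of_le_of_ne (hx.1 i j).2 (Ne.symm hne)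
    set t' := fun i j => max 0 (x.1 i + x.2.1 j - P.C i j) with ht'
    have hle : ∀ i j, t' i j ≤ x.2.2 i j := fun i j => max_le (hx.1 i j).1 (hx.1 i j).2
    have h0 : ∀ i j, 0 ≤ t' i j := fun i j => le_max_left _ _
    have h1 : P.h x ≤ P.h (x.1, x.2.1, t') := hx.2 fun i j => ⟨h0 i j, le_max_right _ _⟩
    have h2 : ∑ i, ∑ j, t' i j ^ 2 < ∑ i, ∑ j, x.2.2 i j ^ 2 := by
      refine Finset.sum_lt_sum (fun i _ => Finset.sum_le_sum fun j _ =>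
        pow_le_pow_left₀ (h0 i j) (hle i j) 2) ⟨i, Finset.mem_univ i, ?_⟩
      refine Finset.sum_lt_sum (fun j _ => pow_le_pow_left₀ (h0 i j) (hle i j) 2)
        ⟨j, Finset.mem_univ j, pow_lt_pow_left₀ (max_lt hij hlt) (h0 i j) two_ne_zero⟩
    have h3 := mul_lt_mul_of_pos_left h2 (show 0 < 1 / (4 * P.η) by positivity)
    simp only [h] at h1
    linarith

end Admissible

/-- The primal plan `t / (2η)`. -/
def plan (P : UOT n) (x : Var n) : Mat n := fun i j => x.2.2 i j / (2 * P.η)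

namespace IsKKT

variable {x : Var n}

theorem plan_nonneg (hP : P.Admissible) (hx : P.IsKKT x) (i j : Fin n) : 0 ≤ P.plan x i j :=
  div_nonneg (hx.feasible i j).1 (by have := hP.η_pos; positivity)

theorem plan_row (hx : P.IsKKT x) (i : Fin n) :
    ∑ j, P.plan x i j = P.a i * Real.exp (-(x.1 i / P.τ)) := by
  rw [← hx.row, one_div_mul_eq_div, Finset.sum_div]; rfl

theorem plan_col (hx : P.IsKKT x) (j : Fin n) :
    ∑ i, P.plan x i j = P.b j * Real.exp (-(x.2.1 j / P.τ)) := by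
  rw [← hx.col, ← one_div_mul_eq_div, Finset.mul_sum]
  simp [plan, div_eq_inv_mul]

theorem t_eq (hP : P.Admissible) (i j : Fin n) : x.2.2 i j = 2 * P.η * P.plan x i j := by
  have := hP.η_pos
  rw [plan]; field_simp

/-- Complementary slackness in product form. -/
theorem plan_mul (hx : P.IsKKT x) (i j : Fin n) :
    P.plan x i j * (x.1 i + x.2.1 j) = P.plan x i j * (P.C i j + x.2.2 i j) := by
  rcases (hx.feasible i j).1.eq_or_lt with h | h
  · rw [plan, ← h, zero_div, zero_mul, zero_mul]
  · rw [hx.slack i j h]; ring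

theorem sum_plan_mul (hx : P.IsKKT x) (p q : Fin n → ℝ) :
    ∑ i, ∑ j, P.plan x i j * (p i + q j) = ∑ i, P.a i * Real.exp (-(x.1 i / P.τ)) * p i
      + ∑ j, P.b j * Real.exp (-(x.2.1 j / P.τ)) * q j := by
  simp only [mul_add, Finset.sum_add_distrib]
  congr 1
  · exact Finset.sum_congr rfl fun i _ => by rw [← Finset.sum_mul, hx.plan_row]
  · rw [Finset.sum_comm]
    exact Finset.sum_congr rfl fun j _ => by rw [← Finset.sum_mul, hx.plan_col]

theorem row_sum (hx : P.IsKKT x) :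
    ∑ i, P.a i * Real.exp (-(x.1 i / P.τ)) = ∑ i, ∑ j, P.plan x i j :=
  Finset.sum_congr rfl fun i _ => (hx.plan_row i).symm

theorem col_sum (hx : P.IsKKT x) :
    ∑ j, P.b j * Real.exp (-(x.2.1 j / P.τ)) = ∑ i, ∑ j, P.plan x i j := by
  rw [Finset.sum_comm]
  exact Finset.sum_congr rfl fun i _ => (hx.plan_col i).symm

/-- By slackness, the plan summed against `u_i + v_j` is nonnegative, as `C` and `t` are. By `exp y
≥ 1 + y`, applied to each marginal, the same sum is at most `2τ` times one minus the mass. -/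
theorem mass_le_one (hP : P.Admissible) (hx : P.IsKKT x) : ∑ i, ∑ j, P.plan x i j ≤ 1 := by
  have hτ := hP.τ_pos
  have key : ∀ p r : ℝ, 0 ≤ p → p * Real.exp (-(r / P.τ)) * r ≤ P.τ * (p - p * Real.exp (-(r / P.τ))) := by
    intro p r hp
    have h1 := Real.add_one_le_exp (r / P.τ)
    have h2 : Real.exp (-(r / P.τ)) * (r / P.τ) ≤ 1 - Real.exp (-(r / P.τ)) := by
      have e : Real.exp (-(r / P.τ)) * Real.exp (r / P.τ) = 1 := by
        rw [← Real.exp_add]; simp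
      nlinarith [Real.exp_pos (-(r / P.τ))]
    have h3 := mul_le_mul_of_nonneg_left h2 (mul_nonneg hτ.le hp)
    have e : P.τ * p * (Real.exp (-(r / P.τ)) * (r / P.τ)) = p * Real.exp (-(r / P.τ)) * r := by
      field_simp
    linarith
  have h1 : 0 ≤ ∑ i, ∑ j, P.plan x i j * (x.1 i + x.2.1 j) := by
    refine Finset.sum_nonneg fun i _ => Finset.sum_nonneg fun j _ => ?_
    rw [hx.plan_mul]
    exact mul_nonneg (hx.plan_nonneg hP i j) (add_nonneg (hP.C_nonneg i j) (hx.feasible i j).1)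
  rw [hx.sum_plan_mul] at h1
  have h2 := Finset.sum_le_sum fun i (_ : i ∈ Finset.univ) => key (P.a i) (x.1 i) (hP.a_mem.1 i)
  have h3 := Finset.sum_le_sum fun i (_ : i ∈ Finset.univ) => key (P.b i) (x.2.1 i) (hP.b_mem.1 i)
  rw [← Finset.mul_sum, Finset.sum_sub_distrib, hP.a_mem.2] at h2
  rw [← Finset.mul_sum, Finset.sum_sub_distrib, hP.b_mem.2] at h3
  rw [hx.row_sum] at h2
  rw [hx.col_sum] at h3
  have h6 : 0 ≤ 2 * P.τ * (1 - ∑ i, ∑ j, P.plan x i j) := by linarith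
  have := nonneg_of_mul_nonneg_right h6 (by positivity)
  linarith

theorem row_le_one (hP : P.Admissible) (hx : P.IsKKT x) (i : Fin n) :
    P.a i * Real.exp (-(x.1 i / P.τ)) ≤ 1 := by
  rw [← hx.plan_row]
  exact (Finset.single_le_sum (f := fun i => ∑ j, P.plan x i j)
    (fun i _ => Finset.sum_nonneg fun j _ => hx.plan_nonneg hP i j) (Finset.mem_univ i)).trans
    (hx.mass_le_one hP)

theorem col_le_one (hP : P.Admissible) (hx : P.IsKKT x) (j : Fin n) :
    P.b j * Real.exp (-(x.2.1 j / P.τ)) ≤ 1 := by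
  rw [← hx.plan_col]
  refine (Finset.single_le_sum (f := fun j => ∑ i, P.plan x i j)
    (fun j _ => Finset.sum_nonneg fun i _ => hx.plan_nonneg hP i j) (Finset.mem_univ j)).trans ?_
  rw [Finset.sum_comm]
  exact hx.mass_le_one hP

theorem plan_le_one (hP : P.Admissible) (hx : P.IsKKT x) (i j : Fin n) : P.plan x i j ≤ 1 := by
  refine (Finset.single_le_sum (f := fun j => P.plan x i j)
    (fun j _ => hx.plan_nonneg hP i j) (Finset.mem_univ j)).trans ?_
  rw [hx.plan_row]
  exact hx.row_le_one hP i

/-- Feasibility bounds `u_i + v_j` by `C_ij + t_ij`, and `t_ij` is `2η` times a plan entry, hence at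
most `2η`. -/
theorem add_le (hP : P.Admissible) (hx : P.IsKKT x) (i j : Fin n) :
    x.1 i + x.2.1 j ≤ normInf P.C + 2 * P.η := by
  have h1 := (hx.feasible i j).2
  have h2 := le_normInf P.C i j
  have h3 := hx.plan_le_one hP i j
  have h4 := t_eq hP (x := x) i j
  have h5 := hP.η_pos
  nlinarith

/-- If every `r i` were negative, every weight would be strictly enlarged and the total would exceed
one. A nonnegative potential on one side turns the bound on `u_i + v_j` into a bound on the other
side alone. -/
theorem exists_nonneg_aux {p r : Fin n → ℝ} {τ : ℝ} (hτ : 0 < τ) (hp : ∀ i, 0 < p i)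
    (hp1 : ∑ i, p i = 1) (h : ∑ i, p i * Real.exp (-(r i / τ)) ≤ 1) : ∃ i, 0 ≤ r i := by
  by_contra hn
  push Not at hn
  have : Nonempty (Fin n) := by
    by_contra he
    rw [not_nonempty_iff] at he
    simp at hp1
  have : ∑ i, p i < ∑ i, p i * Real.exp (-(r i / τ)) :=
    Finset.sum_lt_sum_of_nonempty Finset.univ_nonempty fun i _ =>
      lt_mul_of_one_lt_right (hp i) (Real.one_lt_exp_iff.2 (neg_pos.2 (div_neg_of_neg_of_pos (hn i) hτ)))
  linarith

theorem u_le (hP : P.Admissible) (hx : P.IsKKT x) (i : Fin n) :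
    x.1 i ≤ normInf P.C + 2 * P.η := by
  obtain ⟨j, hj⟩ := exists_nonneg_aux hP.τ_pos hP.b_pos' hP.b_mem.2
    (hx.col_sum.trans_le (hx.mass_le_one hP))
  have := hx.add_le hP i j
  linarith

theorem v_le (hP : P.Admissible) (hx : P.IsKKT x) (j : Fin n) :
    x.2.1 j ≤ normInf P.C + 2 * P.η := by
  obtain ⟨i, hi⟩ := exists_nonneg_aux hP.τ_pos hP.a_pos' hP.a_mem.2
    (hx.row_sum.trans_le (hx.mass_le_one hP))
  have := hx.add_le hP i j
  linarith

/-- Each row has positive mass, hence a positive entry; slackness there gives `u_i ≥ -v_j`, and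
`v_j` is bounded above. Unlike the box, this bound has no logarithm of the marginals, which is what
makes the marginal error small for the tuned `τ`. -/
theorem abs_u_le (hP : P.Admissible) (hx : P.IsKKT x) (i : Fin n) :
    |x.1 i| ≤ normInf P.C + 2 * P.η := by
  rw [abs_le]
  refine ⟨?_, hx.u_le hP i⟩
  have hpos : 0 < ∑ j, P.plan x i j := by
    rw [hx.plan_row]; exact mul_pos (hP.a_pos' i) (Real.exp_pos _)
  obtain ⟨j, -, hj⟩ := Finset.exists_lt_of_sum_lt (f := fun _ => (0 : ℝ)) (s := Finset.univ)
    (by simpa using hpos)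
  have h1 : 0 < x.2.2 i j := by
    rw [t_eq hP]; have := hP.η_pos; positivity
  have h2 := hx.slack i j h1
  have h3 := hP.C_nonneg i j
  have h4 := hx.v_le hP j
  linarith

theorem abs_v_le (hP : P.Admissible) (hx : P.IsKKT x) (j : Fin n) :
    |x.2.1 j| ≤ normInf P.C + 2 * P.η := by
  rw [abs_le]
  refine ⟨?_, hx.v_le hP j⟩
  have hpos : 0 < ∑ i, P.plan x i j := by
    rw [hx.plan_col]; exact mul_pos (hP.b_pos' j) (Real.exp_pos _)
  obtain ⟨i, -, hi⟩ := Finset.exists_lt_of_sum_lt (f := fun _ => (0 : ℝ)) (s := Finset.univ)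
    (by simpa using hpos)
  have h1 : 0 < x.2.2 i j := by
    rw [t_eq hP]; have := hP.η_pos; positivity
  have h2 := hx.slack i j h1
  have h3 := hP.C_nonneg i j
  have h4 := hx.u_le hP i
  linarith

/-- The lower bounds restate that no marginal of the plan exceeds one. Thus restricting the proximal
steps to the box does not exclude the solution. -/
theorem mem_box (hP : P.Admissible) (hx : P.IsKKT x) : x ∈ P.box := by
  have hτ := hP.τ_pos
  have lower : ∀ {p r : ℝ}, 0 < p → p * Real.exp (-(r / P.τ)) ≤ 1 → P.τ * Real.log p ≤ r := by
    intro p r hp h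
    have h1 := Real.log_le_log (mul_pos hp (Real.exp_pos _)) h
    rw [Real.log_mul hp.ne' (Real.exp_pos _).ne', Real.log_exp, Real.log_one] at h1
    have h2 : Real.log p ≤ r / P.τ := by linarith
    have := (le_div_iff₀ hτ).1 h2
    linarith
  rw [hP.mem_box_iff]
  exact ⟨fun i => ⟨lower (hP.a_pos' i) (hx.row_le_one hP i), (hx.u_le hP i).trans hP.le_D⟩,
    fun j => ⟨lower (hP.b_pos' j) (hx.col_le_one hP j), (hx.v_le hP j).trans hP.le_D⟩⟩

/-- Variational inequality of the dual problem. -/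
theorem variational (hP : P.Admissible) (hx : P.IsKKT x) {z : Var n} (hz : z ∈ P.feasible) :
    0 ≤ dot (P.gradF x) (z - x) + P.hess x (z - x) := by
  -- The quadratic terms of `f` and `w` in the potentials cancel, and the marginal equations turn
  -- the remaining exponentials into sums over the plan.
  have h1 : dot (P.gradF x) (z - x) + P.hess x (z - x) = ∑ i, ∑ j, P.plan x i j *
      ((z.2.2 i j - x.2.2 i j) - ((z.1 i - x.1 i) + (z.2.1 j - x.2.1 j))) := by
    simp only [mul_sub (P.plan x _ _) (_ - _), Finset.sum_sub_distrib]
    have e := hx.sum_plan_mul (fun i => z.1 i - x.1 i) fun j => z.2.1 j - x.2.1 j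
    rw [e, hess_apply]
    simp only [dot, gradF, gradW, Prod.fst_sub, Prod.snd_sub, Pi.sub_apply, zero_mul,
      Finset.sum_const_zero, sub_mul, Finset.sum_sub_distrib, neg_mul, Finset.sum_neg_distrib, plan,
      one_div, inv_mul_eq_div]
    ring
  rw [h1]
  refine Finset.sum_nonneg fun i _ => Finset.sum_nonneg fun j _ => ?_
  rcases (hx.feasible i j).1.eq_or_lt with h | h
  · rw [plan, ← h, zero_div, zero_mul]
  · refine mul_nonneg (hx.plan_nonneg hP i j) ?_
    have := (hz i j).2
    have := hx.slack i j h
    linarith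

/-- The plan of a dual solution is nearly as cheap as every coupling. -/
theorem frob_plan_le (hP : P.Admissible) (hx : P.IsKKT x) {Z : Mat n}
    (hZ : Z ∈ couplings P.a P.b) : frob P.C (P.plan x) ≤ frob P.C Z + P.η / 2 := by
  have hη := hP.η_pos
  have hτ := hP.τ_pos
  have hZ1 : ∑ i, ∑ j, Z i j = 1 := by simp only [hZ.2.1, hP.a_mem.2]
  have hZle : ∀ i j, Z i j ≤ 1 := fun i j =>
    ((Finset.single_le_sum (f := fun j => Z i j) (fun j _ => hZ.1 i j) (Finset.mem_univ j)).trans_eq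
      (hZ.2.1 i)).trans (hP.a_le_one i)
  have e1 : ∑ i, ∑ j, Z i j * (x.1 i + x.2.1 j) = ∑ i, P.a i * x.1 i + ∑ j, P.b j * x.2.1 j := by
    simp only [mul_add, Finset.sum_add_distrib]
    congr 1
    · exact Finset.sum_congr rfl fun i _ => by rw [← Finset.sum_mul, hZ.2.1]
    · rw [Finset.sum_comm]
      exact Finset.sum_congr rfl fun j _ => by rw [← Finset.sum_mul, hZ.2.2]
  have e2 := hx.sum_plan_mul x.1 x.2.1
  -- The damping factor is below one where `r` is positive and above one where `r` is negative, so
  -- it lowers the product in both cases.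
  have mono : ∀ p r : ℝ, 0 ≤ p → p * Real.exp (-(r / P.τ)) * r ≤ p * r := by
    intro p r hp
    rw [mul_assoc]
    refine mul_le_mul_of_nonneg_left ?_ hp
    rcases le_total 0 r with hr | hr
    · exact mul_le_of_le_one_left hr (Real.exp_le_one_iff.2 (neg_nonpos.2 (by positivity)))
    · have : 1 ≤ Real.exp (-(r / P.τ)) :=
        Real.one_le_exp (neg_nonneg.2 (div_nonpos_of_nonpos_of_nonneg hr hτ.le))
      nlinarith
  have e3 := Finset.sum_le_sum fun i (_ : i ∈ Finset.univ) => mono (P.a i) (x.1 i) (hP.a_mem.1 i)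
  have e4 := Finset.sum_le_sum fun i (_ : i ∈ Finset.univ) => mono (P.b i) (x.2.1 i) (hP.b_mem.1 i)
  have e5 : ∑ i, ∑ j, P.plan x i j * (x.1 i + x.2.1 j) ≤ ∑ i, ∑ j, Z i j * (x.1 i + x.2.1 j) := by
    linarith
  have e6 : ∑ i, ∑ j, (P.C i j * P.plan x i j - P.plan x i j * (x.1 i + x.2.1 j))
      ≤ ∑ i, ∑ j, (P.C i j * Z i j - Z i j * (x.1 i + x.2.1 j) + P.η / 2 * Z i j) := by
    refine Finset.sum_le_sum fun i _ => Finset.sum_le_sum fun j _ => ?_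
    rw [hx.plan_mul]
    have h1 := mul_le_mul_of_nonneg_left (hx.feasible i j).2 (hZ.1 i j)
    have h2 := t_eq hP (x := x) i j
    rw [h2] at h1 ⊢
    have h3 := mul_le_mul_of_nonneg_left (hZle i j) (hZ.1 i j)
    -- After slackness only `-2η p² ≤ -2η Z p + (η/2) Z` is left for the plan entry `p`; complete
    -- the square and use `Z² ≤ Z`.
    nlinarith [sq_nonneg (P.plan x i j - Z i j / 2)]
  simp only [Finset.sum_sub_distrib, Finset.sum_add_distrib, ← Finset.mul_sum, hZ1] at e6
  unfold frob
  linarith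

end IsKKT

end UOT

/-! ### Convergence of the iterates and of their weighted average. -/

namespace UOT

variable {P : UOT n}

theorem h_eq (P : UOT n) (x : Var n) : P.h x = P.f x + P.w x := by
  rw [h, f, w]; ring

namespace Admissible

theorem L_eq (hP : P.Admissible) : P.L = 1 / P.τ + P.modulus := by
  have := hP.τ_pos
  rw [L, hP.mass_eq]; field_simp

/-- Cocoercivity of the scalar summands of `f` between the box bounds. -/
theorem scalar_cocoercive (hP : P.Admissible) {p : ℝ} (hp : P.low ≤ p) {x y : ℝ}
    (hx : P.τ * Real.log p ≤ x ∧ x ≤ P.D) (hy : P.τ * Real.log p ≤ y ∧ y ≤ P.D) :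
    P.τ * (Real.exp (-(x / P.τ)) * p) - P.modulus / 2 * x ^ 2
      + (-(p * Real.exp (-(x / P.τ))) - P.modulus * x) * (y - x)
      + 1 / (2 * P.L) * ((-(p * Real.exp (-(y / P.τ))) - P.modulus * y)
        - (-(p * Real.exp (-(x / P.τ))) - P.modulus * x)) ^ 2
      ≤ P.τ * (Real.exp (-(y / P.τ)) * p) - P.modulus / 2 * y ^ 2 := by
  have hτ := hP.τ_pos
  have hp0 : 0 < p := hP.low_pos.trans_le hp
  have hexp : ∀ z, HasDerivAt (fun z => Real.exp (-(z / P.τ))) (Real.exp (-(z / P.τ)) * -(1 / P.τ)) z :=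
    fun z => (((hasDerivAt_id z).div_const P.τ).fun_neg).exp
  refine sq_deriv_sub_le_bregman (φ := fun x => P.τ * (Real.exp (-(x / P.τ)) * p) - P.modulus / 2 * x ^ 2)
    (g := fun x => -(p * Real.exp (-(x / P.τ))) - P.modulus * x)
    (g' := fun x => p * Real.exp (-(x / P.τ)) / P.τ - P.modulus) (lo := P.τ * Real.log p) (hi := P.D)
    hP.L_pos (fun z => ?_) (fun z => ?_) (fun z hz => ?_) (fun z hz => ?_) hx hy
  · refine ((((hexp z).mul_const p).const_mul P.τ).sub
      (((hasDerivAt_id z).fun_pow 2).const_mul (P.modulus / 2))).congr_deriv ?_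
    simp only [id]
    field_simp
    push_cast
    ring
  · refine (((hexp z).const_mul p).fun_neg.sub ((hasDerivAt_id z).const_mul P.modulus)).congr_deriv ?_
    ring
  -- The upper end of the box keeps the curvature of the exponential above `modulus`, so subtracting
  -- the quadratic leaves `f` convex.
  · have h1 : Real.exp (-(P.D / P.τ)) ≤ Real.exp (-(z / P.τ)) :=
      Real.exp_le_exp.2 (neg_le_neg (div_le_div_of_nonneg_right hz.2 hτ.le))
    have h2 := mul_le_mul hp h1 (Real.exp_pos _).le hp0.le
    have h3 := div_le_div_of_nonneg_right h2 hτ.le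
    rw [sub_nonneg, modulus, div_mul_eq_mul_div]
    exact h3
  -- The lower end `τ log p` of the box is exactly where this weight equals one.
  · have h1 : p * Real.exp (-(z / P.τ)) ≤ 1 := by
      have : Real.log p ≤ z / P.τ := (le_div_iff₀ hτ).2 (by linarith [hz.1])
      calc p * Real.exp (-(z / P.τ)) ≤ p * Real.exp (-Real.log p) :=
            mul_le_mul_of_nonneg_left (Real.exp_le_exp.2 (neg_le_neg this)) hp0.le
        _ = 1 := by rw [Real.exp_neg, Real.exp_log hp0, mul_inv_cancel₀ hp0.ne']
    have h2 := div_le_div_of_nonneg_right h1 hτ.le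
    have h3 := hP.modulus_pos
    rw [hP.L_eq]
    linarith

/-- Cocoercivity of `f` on the localisation set. -/
theorem f_cocoercive (hP : P.Admissible) {x y : Var n} (hx : x ∈ P.box) (hy : y ∈ P.box) :
    P.f x + dot (P.gradF x) (y - x)
      + 1 / (2 * P.L) * dot (P.gradF y - P.gradF x) (P.gradF y - P.gradF x) ≤ P.f y := by
  rw [hP.mem_box_iff] at hx hy
  have h1 := Finset.sum_le_sum fun i (_ : i ∈ Finset.univ) =>
    hP.scalar_cocoercive (P.low_le_a i) (hx.1 i) (hy.1 i)
  have h2 := Finset.sum_le_sum fun i (_ : i ∈ Finset.univ) =>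
    hP.scalar_cocoercive (P.low_le_b i) (hx.2 i) (hy.2 i)
  simp only [Finset.sum_add_distrib, Finset.sum_sub_distrib (fun i => P.τ * _),
    ← Finset.mul_sum] at h1 h2
  simp only [f, dot, gradF, Prod.fst_sub, Prod.snd_sub, Pi.sub_apply, zero_mul, sub_zero,
    Finset.sum_const_zero, add_zero]
  simp only [← sq]
  linarith

end Admissible

/-- The root `√(1 + 16 L / μ)` governing the rate. -/
def root (P : UOT n) : ℝ := Real.sqrt (1 + 16 * P.L / P.mu)

/-- The initial memory of the gradient extrapolation method. -/
def initial (n : ℕ) : State n := ⟨0, 0, 0, 0, 1, 0, 0⟩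

/-- The memory after `k` iterations. -/
def run (c : ℕ) (P : UOT n) (k : ℕ) : State n :=
  (Timed.loop (iteration c P (constsProg P).val) k (initial n)).val

theorem consts_α' (P : UOT n) : (constsProg P).val.α = 1 - 1 / (1 + P.root) := rfl

theorem consts_ψ' (P : UOT n) :
    (constsProg P).val.ψ = 1 / (1 - (constsProg P).val.α) - 1 := rfl

theorem consts_ρ' (P : UOT n) :
    (constsProg P).val.ρ = (constsProg P).val.α / (1 - (constsProg P).val.α) * P.mu := rfl

theorem root_nonneg (P : UOT n) : 0 ≤ P.root := Real.sqrt_nonneg _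

/-- With `s` the root, the parameters are `α = s/(1+s)`, `ψ = s` and `ρ = sμ`, the form used by the
abstract rate. -/
theorem consts_α (P : UOT n) : (constsProg P).val.α = P.root / (1 + P.root) := by
  have := P.root_nonneg
  rw [consts_α']; field_simp; ring

theorem consts_ψ (P : UOT n) : (constsProg P).val.ψ = P.root := by
  have := P.root_nonneg
  rw [consts_ψ', consts_α', sub_sub_cancel, one_div_one_div]; ring

theorem consts_ρ (P : UOT n) : (constsProg P).val.ρ = P.root * P.mu := by
  have := P.root_nonneg
  rw [consts_ρ', consts_α', sub_sub_cancel]; field_simp; ring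

section Run

variable (c : ℕ) (P : UOT n) (k : ℕ)

theorem run_x : (run c P (k + 1)).x = P.prox ((run c P k).y
    + (P.root / (1 + P.root)) • ((run c P k).y - (run c P k).yprev)) (run c P k).x
      (P.root * P.mu) := by
  rw [← consts_α, ← consts_ρ]; rfl

theorem run_xbar : (run c P (k + 1)).xbar =
    (1 + P.root)⁻¹ • ((run c P (k + 1)).x + P.root • (run c P k).xbar) := by
  have h : (run c P (k + 1)).xbar = (1 + (constsProg P).val.ψ)⁻¹ •
      ((run c P (k + 1)).x + (constsProg P).val.ψ • (run c P k).xbar) := by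
    refine Prod.ext (funext fun i => ?_) (Prod.ext (funext fun i => ?_)
      (funext fun i => funext fun j => ?_)) <;>
    exact div_eq_inv_mul _ _
  rw [h, consts_ψ]

theorem run_y : (run c P (k + 1)).y = P.gradF (run c P (k + 1)).xbar := rfl

theorem run_yprev : (run c P (k + 1)).yprev = (run c P k).y := rfl

theorem run_θ : (run c P (k + 1)).θ = (run c P k).θ / (P.root / (1 + P.root)) := by
  rw [← consts_α]; rfl

theorem run_acc (i j : Fin n) : (run c P (k + 1)).acc.2.2 i j =
    (run c P k).acc.2.2 i j + (run c P (k + 1)).θ * (run c P (k + 1)).x.2.2 i j := rfl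

theorem run_wt : (run c P (k + 1)).wt = (run c P k).wt + (run c P (k + 1)).θ := rfl

end Run

namespace Admissible

variable (c : ℕ)

theorem root_sq (hP : P.Admissible) : P.root ^ 2 = 1 + 16 * P.L / P.mu := by
  have := hP.L_pos
  have := hP.mu_pos
  exact Real.sq_sqrt (by positivity)

theorem one_lt_root (hP : P.Admissible) : 1 < P.root := by
  have h := hP.root_sq
  have : 0 < 16 * P.L / P.mu := by
    have := hP.L_pos
    have := hP.mu_pos
    positivity
  nlinarith [P.root_nonneg]

theorem run_x_mem (hP : P.Admissible) (k : ℕ) : (run c P k).x ∈ P.box ∩ P.feasible := by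
  cases k with
  | zero => exact ⟨hP.zero_mem_box, hP.zero_mem_feasible⟩
  | succ k =>
    rw [run_x]
    exact (hP.isProx_prox _ _ (mul_nonneg P.root_nonneg hP.mu_pos.le)).1

/-- The extrapolation points are convex combinations of earlier iterates, so they stay where `f` is
cocoercive. -/
theorem run_xbar_mem (hP : P.Admissible) (k : ℕ) : (run c P k).xbar ∈ P.box ∩ P.feasible := by
  have hs := P.root_nonneg
  induction k with
  | zero => exact ⟨hP.zero_mem_box, hP.zero_mem_feasible⟩
  | succ k ih =>
    rw [run_xbar, smul_add, smul_smul]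
    exact P.convex_domain (hP.run_x_mem c (k + 1)) ih (by positivity) (by positivity)
      (by field_simp)

/-- Linear convergence of the iterates to a dual solution. -/
theorem run_rate (hP : P.Admissible) {xs : Var n} (hxs : P.IsKKT xs) (k : ℕ) :
    P.hess ((run c P k).x - xs) ((run c P k).x - xs)
      ≤ 4 * P.Delta xs * (P.root / (1 + P.root)) ^ k := by
  have hμ := hP.mu_pos
  have hs := hP.one_lt_root
  have hs1 : 0 < 1 + P.root := by linarith
  have hxsV : xs ∈ P.box ∩ P.feasible := ⟨hxs.mem_box hP, hxs.feasible⟩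
  have key := gradient_extrapolation_rate (dotB n) P.hess dot_comm P.hess_comm dot_self_nonneg
    hμ hP.L_pos hs.le (by rw [hP.root_sq]; field_simp; linarith) P.mu_mul_dot_le
    (V := P.box ∩ P.feasible) (f := P.f) (G := P.gradF)
    (fun x hx y hy => hP.f_cocoercive hx.1 hy.1) hxsV (fun z hz => hxs.variational hP hz.2)
    (x := fun k => (run c P k).x) (xb := fun k => (run c P k).xbar)
    (y := fun k => (run c P k).y) (δ := fun k => (run c P k).y - (run c P k).yprev)
    (hP.run_x_mem c) (hP.run_xbar_mem c) rfl (sub_self _) (fun k => by rw [run_yprev])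
    (fun k => run_y c P k)
    (fun k z hz => by
      have h := hP.isProx_variational (hP.isProx_prox ((run c P k).y
        + (P.root / (1 + P.root)) • ((run c P k).y - (run c P k).yprev)) (run c P k).x
        (mul_nonneg P.root_nonneg hμ.le)) hz
      rwa [← run_x, mul_div_cancel_right₀ _ hμ.ne'] at h)
    (fun k => by rw [run_xbar, smul_smul, mul_inv_cancel₀ hs1.ne', one_smul]) k
  have x0 : (run c P 0).x = 0 := rfl
  have xb0 : (run c P 0).xbar = 0 := rfl
  simp only [x0, xb0, dotB_apply] at key
  -- Testing optimality of `xs` at the starting point `0` compares the initial potential with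
  -- `Delta`, where `h` replaces `f`.
  have hv := hxs.variational hP hP.zero_mem_feasible
  have hq := hP.hess_self_nonneg xs
  have hΔ : P.Delta xs = P.hess xs xs / 2 + (P.f 0 - P.f xs - P.hess xs xs / 2)
      + dot (P.gradF 0) (P.gradF 0) / P.mu := by
    rw [Delta, bregman_eq, h_eq, h_eq, w_eq, w_eq, sub_zero, mul_div_cancel₀ _ hμ.ne']
    simp
    ring
  rw [zero_sub, map_neg (P.hess xs)] at hv
  have e1 : (1 + P.root) / 2 * P.hess (0 - xs) (0 - xs) = (1 + P.root) * (P.hess xs xs / 2) := by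
    rw [zero_sub]; simp; ring
  have e2 : 2 / (P.root * P.mu) * dot (P.gradF 0) (P.gradF 0)
      ≤ (1 + P.root) * (dot (P.gradF 0) (P.gradF 0) / P.mu) := by
    have hg : 0 ≤ dot (P.gradF 0) (P.gradF 0) / P.mu := div_nonneg (dot_self_nonneg _) hμ.le
    have h2 : 2 / P.root ≤ 1 + P.root := by
      rw [div_le_iff₀ (by linarith)]; nlinarith
    calc _ = 2 / P.root * (dot (P.gradF 0) (P.gradF 0) / P.mu) := by field_simp
      _ ≤ _ := mul_le_mul_of_nonneg_right h2 hg
  have e3 : (1 + P.root) / 2 * P.hess (0 - xs) (0 - xs)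
      + (1 + P.root) * (P.f 0 - P.f xs - dot (P.gradF xs) (0 - xs))
      + 2 / (P.root * P.mu) * dot (P.gradF 0) (P.gradF 0) ≤ (1 + P.root) * P.Delta xs := by
    rw [hΔ, e1, zero_sub]
    have := mul_le_mul_of_nonneg_left (show P.f 0 - P.f xs - dot (P.gradF xs) (-xs)
      ≤ P.f 0 - P.f xs - P.hess xs xs / 2 by linarith) hs1.le
    linarith
  have h4 := key.trans (mul_le_mul_of_nonneg_left e3 (by positivity))
  have h5 : (1 + P.root) / 4 * P.hess ((run c P k).x - xs) ((run c P k).x - xs)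
      ≤ (1 + P.root) / 4 * (4 * P.Delta xs * (P.root / (1 + P.root)) ^ k) := by
    refine h4.trans_eq ?_
    ring
  exact le_of_mul_le_mul_left h5 (by positivity)

theorem dot_gradF_zero (P : UOT n) : dot (P.gradF 0) (P.gradF 0)
    = ∑ i, P.a i ^ 2 + ∑ j, P.b j ^ 2 := by
  simp [dot, gradF, sq]

/-- The initial gap dominates the squared initial gradient. -/
theorem Delta_ge (hP : P.Admissible) {xs : Var n} (hxs : P.IsDualSolution xs) :
    (∑ i, P.a i ^ 2 + ∑ j, P.b j ^ 2) / P.mu ≤ P.Delta xs := by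
  have hμ := hP.mu_pos
  have h1 : P.h xs ≤ P.h 0 := hxs.2 hP.zero_mem_feasible
  have h2 := hP.hess_self_nonneg xs
  rw [Delta, bregman_eq, sub_zero, mul_div_cancel₀ _ hμ.ne', dot_gradF_zero]
  linarith

/-- The entrywise distance of the iterates from the dual solution. -/
theorem run_t_dist (hP : P.Admissible) {xs : Var n} (hxs : P.IsDualSolution xs) (k : ℕ) :
    ∑ i, ∑ j, |(run c P k).x.2.2 i j - xs.2.2 i j|
      ≤ 2 * n * Real.sqrt (P.Delta xs / P.mu) * Real.sqrt (P.root / (1 + P.root)) ^ k := by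
  have hμ := hP.mu_pos
  have hs := P.root_nonneg
  have hΔ : 0 ≤ P.Delta xs := le_trans (by positivity) (hP.Delta_ge hxs)
  have h1 := (P.mu_mul_dot_le _).trans (hP.run_rate c (hP.isKKT hxs) k)
  set z := (run c P k).x - xs with hz
  have e1 : ∀ i j, (run c P k).x.2.2 i j - xs.2.2 i j = z.2.2 i j := fun i j => rfl
  simp only [e1]
  have h2 : ∑ i, ∑ j, |z.2.2 i j| ^ 2 ≤ dot z z := by
    simp only [sq_abs]
    simp only [dot, sq]
    have : 0 ≤ ∑ i, z.1 i * z.1 i := Finset.sum_nonneg fun i _ => mul_self_nonneg _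
    have : 0 ≤ ∑ i, z.2.1 i * z.2.1 i := Finset.sum_nonneg fun i _ => mul_self_nonneg _
    linarith
  -- Cauchy–Schwarz over `n²` entries, applied row by row.
  have h3 : (∑ i, ∑ j, |z.2.2 i j|) ^ 2 ≤ n ^ 2 * ∑ i, ∑ j, |z.2.2 i j| ^ 2 := by
    have g1 : (∑ i, ∑ j, |z.2.2 i j|) ^ 2 ≤ (n : ℝ) * ∑ i, (∑ j, |z.2.2 i j|) ^ 2 := by
      simpa using sq_sum_le_card_mul_sum_sq (s := Finset.univ) (f := fun i => ∑ j, |z.2.2 i j|)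
    have g2 : ∀ i, (∑ j, |z.2.2 i j|) ^ 2 ≤ (n : ℝ) * ∑ j, |z.2.2 i j| ^ 2 := fun i => by
      simpa using sq_sum_le_card_mul_sum_sq (s := Finset.univ) (f := fun j => |z.2.2 i j|)
    have g3 := Finset.sum_le_sum fun i (_ : i ∈ Finset.univ) => g2 i
    rw [← Finset.mul_sum] at g3
    have g4 := mul_le_mul_of_nonneg_left g3 (Nat.cast_nonneg (α := ℝ) n)
    calc _ ≤ _ := g1
      _ ≤ _ := g4
      _ = _ := by ring
  refine abs_le_of_sq_le_sq' ?_ (by positivity) |>.2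
  have h4 : dot z z ≤ 4 * (P.Delta xs / P.mu) * (P.root / (1 + P.root)) ^ k := by
    rw [mul_div_assoc', div_mul_eq_mul_div, le_div_iff₀ hμ]
    linarith
  calc _ ≤ _ := h3
    _ ≤ (n : ℝ) ^ 2 * (4 * (P.Delta xs / P.mu) * (P.root / (1 + P.root)) ^ k) :=
      mul_le_mul_of_nonneg_left (h2.trans h4) (by positivity)
    _ = _ := by
      rw [mul_pow, mul_pow, mul_pow, Real.sq_sqrt (by positivity), ← pow_mul, mul_comm k 2, pow_mul,
        Real.sq_sqrt (by positivity)]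
      ring

theorem run_wt_pos (hP : P.Admissible) (k : ℕ) :
    0 < (run c P k).θ ∧ 0 ≤ (run c P k).wt ∧ (0 < k → 0 < (run c P k).wt) := by
  have hs := hP.one_lt_root
  induction k with
  | zero => exact ⟨one_pos, le_rfl, fun h => absurd h (lt_irrefl 0)⟩
  | succ k ih =>
    have h1 : 0 < (run c P (k + 1)).θ := by
      rw [run_θ]
      have := ih.1
      positivity
    have h2 : 0 < (run c P (k + 1)).wt := by rw [run_wt]; linarith [ih.2.1]
    exact ⟨h1, h2.le, fun _ => h2⟩

theorem run_acc_nonneg (hP : P.Admissible) (k : ℕ) (i j : Fin n) :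
    0 ≤ (run c P k).acc.2.2 i j := by
  induction k with
  | zero => exact le_rfl
  | succ k ih =>
    rw [run_acc]
    exact add_nonneg ih (mul_nonneg (hP.run_wt_pos c _).1.le ((hP.run_x_mem c _).2 i j).1)

/-- The distance of the weighted average from the dual solution. -/
theorem run_average_dist (hP : P.Admissible) {xs : Var n} (hxs : P.IsDualSolution xs) {k : ℕ}
    (hk : 0 < k) :
    ∑ i, ∑ j, |(run c P k).acc.2.2 i j / (run c P k).wt - xs.2.2 i j|
      ≤ 4 * n * Real.sqrt (P.Delta xs / P.mu) * Real.sqrt (P.root / (1 + P.root)) ^ k := by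
  have hs := hP.one_lt_root
  set σ := Real.sqrt (P.root / (1 + P.root)) with hσ
  set R := 2 * n * Real.sqrt (P.Delta xs / P.mu) with hR
  have hR0 : 0 ≤ R := by positivity
  have hα : 0 < P.root / (1 + P.root) := by positivity
  have hα1 : P.root / (1 + P.root) ≤ 1 := (div_le_one (by linarith)).2 (by linarith)
  have hσ0 : 0 < σ := Real.sqrt_pos.2 hα
  have hσ1 : σ ≤ 1 := Real.sqrt_le_one.2 hα1
  have hσ2 : σ ^ 2 = P.root / (1 + P.root) := Real.sq_sqrt hα.le
  have hθ : ∀ k, (run c P k).θ = (σ⁻¹ ^ 2) ^ k := by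
    intro k
    induction k with
    | zero => rfl
    | succ k ih => rw [run_θ, ih, ← hσ2, pow_succ (σ⁻¹ ^ 2) k, inv_pow, div_eq_mul_inv]
  set s : ℕ → ℝ := fun k => ∑ l ∈ Finset.range k, σ⁻¹ ^ (l + 1) with hs'
  have hsum : ∀ k, ∑ i, ∑ j, |(run c P k).acc.2.2 i j - (run c P k).wt * xs.2.2 i j| ≤ R * s k := by
    intro k
    induction k with
    | zero =>
      have : ∀ i j, |(run c P 0).acc.2.2 i j - (run c P 0).wt * xs.2.2 i j| = 0 := fun i j => by
        have h1 : (run c P 0).acc.2.2 i j = 0 := rfl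
        have h2 : (run c P 0).wt = 0 := rfl
        rw [h1, h2]; simp
      simp [this, hs']
    | succ k ih =>
      have h1 := hP.run_t_dist c hxs (k + 1)
      have h2 : ∀ i j, |(run c P (k + 1)).acc.2.2 i j - (run c P (k + 1)).wt * xs.2.2 i j|
          ≤ |(run c P k).acc.2.2 i j - (run c P k).wt * xs.2.2 i j|
            + (run c P (k + 1)).θ * |(run c P (k + 1)).x.2.2 i j - xs.2.2 i j| := fun i j => by
        rw [show (run c P (k + 1)).θ * |(run c P (k + 1)).x.2.2 i j - xs.2.2 i j|
          = |(run c P (k + 1)).θ * ((run c P (k + 1)).x.2.2 i j - xs.2.2 i j)| by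
            rw [abs_mul, abs_of_pos (hP.run_wt_pos c (k + 1)).1], run_acc, run_wt]
        refine (le_of_eq ?_).trans (abs_add_le _ _)
        congr 1
        ring
      have h3 := Finset.sum_le_sum fun i (_ : i ∈ Finset.univ) =>
        Finset.sum_le_sum fun j (_ : j ∈ Finset.univ) => h2 i j
      simp only [Finset.sum_add_distrib, ← Finset.mul_sum] at h3
      have h4 := mul_le_mul_of_nonneg_left h1 (hP.run_wt_pos c (k + 1)).1.le
      -- The weight grows like `σ⁻²` per step while the distance decays like `σ`, so the accumulated
      -- error is a geometric sum in `σ⁻¹`, to be compared with the sum of weights in `σ⁻²`.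
      have h5 : (run c P (k + 1)).θ * (R * σ ^ (k + 1)) = R * σ⁻¹ ^ (k + 1) := by
        rw [hθ, ← pow_mul, mul_comm 2, pow_mul, sq, inv_pow]
        field_simp
      rw [h5] at h4
      have h6 : s (k + 1) = s k + σ⁻¹ ^ (k + 1) := Finset.sum_range_succ _ _
      rw [h6, mul_add]
      linarith
  have hgeom := pow_mul_geom_le (b := σ⁻¹) ((one_le_inv₀ hσ0).2 hσ1) (s := s)
    (S := fun k => (run c P k).wt) (by simp [hs']) rfl (fun k => Finset.sum_range_succ _ _)
    (fun k => by rw [run_wt, hθ]) k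
  have hw := (hP.run_wt_pos c k).2.2 hk
  have e : ∀ i j, |(run c P k).acc.2.2 i j / (run c P k).wt - xs.2.2 i j|
      = (run c P k).wt⁻¹ * |(run c P k).acc.2.2 i j - (run c P k).wt * xs.2.2 i j| := fun i j => by
    rw [← abs_of_pos (inv_pos.2 hw), ← abs_mul]
    congr 1
    field_simp
  simp only [e, ← Finset.mul_sum]
  rw [inv_mul_le_iff₀ hw]
  refine (hsum k).trans ?_
  have h7 : s k ≤ 2 * (run c P k).wt * σ ^ k := by
    have : σ⁻¹ ^ k * s k * σ ^ k = s k := by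
      rw [inv_pow]; field_simp
    rw [← this]
    exact mul_le_mul_of_nonneg_right hgeom (by positivity)
  calc R * s k ≤ R * (2 * (run c P k).wt * σ ^ k) := mul_le_mul_of_nonneg_left h7 hR0
    _ = _ := by rw [hR]; ring

end Admissible

end UOT

/-! ### Rounding to a coupling, and transport costs. -/

theorem min_div_one_mul {p r : ℝ} (hp : 0 ≤ p) (hr : 0 ≤ r) : min (p / r) 1 * r = min p r := by
  rcases hr.eq_or_lt with rfl | h
  · simp [hp]
  · rw [min_mul_of_nonneg _ _ hr, div_mul_cancel₀ _ h.ne', one_mul]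

/-- The rounding procedure returns a coupling and moves little mass. -/
theorem proj_spec {C X : Mat n} {a b : Fin n → ℝ} (hC : ∀ i j, 0 ≤ C i j) (hX : ∀ i j, 0 ≤ X i j)
    (ha : a ∈ simplex n) (hb : b ∈ simplex n) :
    (proj X a b).val ∈ couplings a b ∧ frob C (proj X a b).val ≤ frob C X
      + normInf C * (∑ i, |∑ j, X i j - a i| + ∑ j, |∑ i, X i j - b j|) := by
  obtain ⟨ha0, ha1⟩ := ha
  obtain ⟨hb0, hb1⟩ := hb
  set x : Fin n → ℝ := fun i => min (a i / ∑ j, X i j) 1 with hx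
  set X' : Mat n := fun i j => x i * X i j with hX'
  set y : Fin n → ℝ := fun j => min (b j / ∑ i, X' i j) 1 with hy
  set Z : Mat n := fun i j => X' i j * y j with hZ
  set er : Fin n → ℝ := fun i => a i - ∑ j, Z i j with her
  set ec : Fin n → ℝ := fun j => b j - ∑ i, Z i j with hec
  set e : ℝ := ∑ i, |er i| with he
  have hval : (proj X a b).val = fun i j => Z i j + er i * ec j / e := rfl
  rw [hval]
  have hr0 : ∀ i, 0 ≤ ∑ j, X i j := fun i => Finset.sum_nonneg fun j _ => hX i j
  have hx0 : ∀ i, 0 ≤ x i := fun i => le_min (div_nonneg (ha0 i) (hr0 i)) zero_le_one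
  have hX'0 : ∀ i j, 0 ≤ X' i j := fun i j => mul_nonneg (hx0 i) (hX i j)
  have hX'X : ∀ i j, X' i j ≤ X i j := fun i j => mul_le_of_le_one_left (hX i j) (min_le_right _ _)
  have hs0 : ∀ j, 0 ≤ ∑ i, X' i j := fun j => Finset.sum_nonneg fun i _ => hX'0 i j
  have hy0 : ∀ j, 0 ≤ y j := fun j => le_min (div_nonneg (hb0 j) (hs0 j)) zero_le_one
  have hZ0 : ∀ i j, 0 ≤ Z i j := fun i j => mul_nonneg (hX'0 i j) (hy0 j)
  have hZX' : ∀ i j, Z i j ≤ X' i j :=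
    fun i j => mul_le_of_le_one_right (hX'0 i j) (min_le_right _ _)
  have hrow : ∀ i, ∑ j, X' i j = min (a i) (∑ j, X i j) := fun i => by
    rw [← min_div_one_mul (ha0 i) (hr0 i), Finset.mul_sum]
  have hcol : ∀ j, ∑ i, Z i j = min (b j) (∑ i, X' i j) := fun j => by
    rw [← min_div_one_mul (hb0 j) (hs0 j), mul_comm, Finset.sum_mul]
  have her0 : ∀ i, 0 ≤ er i := fun i => sub_nonneg.2 <|
    (Finset.sum_le_sum fun j _ => hZX' i j).trans ((hrow i).trans_le (min_le_left _ _))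
  have hec0 : ∀ j, 0 ≤ ec j := fun j => sub_nonneg.2 ((hcol j).trans_le (min_le_left _ _))
  have her_sum : ∑ i, er i = e := Finset.sum_congr rfl fun i _ => (abs_of_nonneg (her0 i)).symm
  have hec_sum : ∑ j, ec j = e := by
    rw [← her_sum, Finset.sum_sub_distrib, Finset.sum_sub_distrib, ha1, hb1, Finset.sum_comm]
  have he0 : 0 ≤ e := her_sum ▸ Finset.sum_nonneg fun i _ => her0 i
  -- When `e = 0` all residuals vanish, so the value `0` of the quotient is the right correction.
  have hfix : ∀ r, (e = 0 → r = 0) → r * e / e = r := fun r hr => by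
    by_cases h : e = 0
    · rw [hr h, zero_mul, zero_div]
    · exact mul_div_cancel_right₀ r h
  have her_z : ∀ i, e = 0 → er i = 0 := fun i h =>
    (Finset.sum_eq_zero_iff_of_nonneg fun i _ => her0 i).1 (her_sum.trans h) i (Finset.mem_univ i)
  have hec_z : ∀ i, e = 0 → ec i = 0 := fun i h =>
    (Finset.sum_eq_zero_iff_of_nonneg fun i _ => hec0 i).1 (hec_sum.trans h) i (Finset.mem_univ i)
  have hrow' : ∀ i, ∑ j, er i * ec j / e = er i := fun i => by
    rw [← Finset.sum_div, ← Finset.mul_sum, hec_sum, hfix _ (her_z i)]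
  have hcol' : ∀ j, ∑ i, er i * ec j / e = ec j := fun j => by
    rw [← Finset.sum_div, ← Finset.sum_mul, her_sum, mul_comm, hfix _ (hec_z j)]
  have hcorr : ∀ i j, 0 ≤ er i * ec j / e := fun i j =>
    div_nonneg (mul_nonneg (her0 i) (hec0 j)) he0
  refine ⟨⟨fun i j => add_nonneg (hZ0 i j) (hcorr i j), fun i => ?_, fun j => ?_⟩, ?_⟩
  · rw [Finset.sum_add_distrib, hrow', her]; ring
  · rw [Finset.sum_add_distrib, hcol', hec]; ring
  · have h1 : e ≤ ∑ i, |∑ j, X i j - a i| + ∑ j, |∑ i, X i j - b j| := by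
      have e1 : ∑ j, ∑ i, X' i j = ∑ i, min (a i) (∑ j, X i j) := by
        rw [Finset.sum_comm]; exact Finset.sum_congr rfl fun i _ => hrow i
      -- The missing mass is the deficit of the rows of `X` plus the excess of the columns of `X'`;
      -- since `X' ≤ X`, each part is bounded by a marginal defect of `X`.
      have e2 : e = ∑ i, (a i - min (a i) (∑ j, X i j))
          + ∑ j, (∑ i, X' i j - min (b j) (∑ i, X' i j)) := by
        rw [← hec_sum, Finset.sum_sub_distrib, Finset.sum_sub_distrib, Finset.sum_sub_distrib, ← e1,
          ha1, hb1]
        simp only [hcol]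
        ring
      rw [e2]
      refine add_le_add (Finset.sum_le_sum fun i _ => ?_) (Finset.sum_le_sum fun j _ => ?_)
      · have := abs_nonneg (∑ j, X i j - a i)
        have := neg_abs_le (∑ j, X i j - a i)
        rcases min_choice (a i) (∑ j, X i j) with h | h <;> rw [h] <;> linarith
      · have h3 : ∑ i, X' i j ≤ ∑ i, X i j := Finset.sum_le_sum fun i _ => hX'X i j
        have := abs_nonneg (∑ i, X i j - b j)
        have := le_abs_self (∑ i, X i j - b j)
        rcases min_choice (b j) (∑ i, X' i j) with h | h <;> rw [h] <;> linarith
    have h2 : frob C (fun i j => Z i j + er i * ec j / e)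
        ≤ ∑ i, ∑ j, (C i j * X i j + normInf C * (er i * ec j / e)) := by
      refine Finset.sum_le_sum fun i _ => Finset.sum_le_sum fun j _ => ?_
      rw [mul_add]
      exact add_le_add (mul_le_mul_of_nonneg_left ((hZX' i j).trans (hX'X i j)) (hC i j))
        (mul_le_mul_of_nonneg_right (le_normInf C i j) (hcorr i j))
    simp only [Finset.sum_add_distrib, ← Finset.mul_sum, hrow', her_sum] at h2
    have h3 := mul_le_mul_of_nonneg_left h1 (normInf_nonneg C)
    unfold frob at h2 ⊢
    linarith

theorem couplings_nonempty {a b : Fin n → ℝ} (ha : a ∈ simplex n) (hb : b ∈ simplex n) :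
    (couplings a b).Nonempty :=
  ⟨fun i j => a i * b j, fun i j => mul_nonneg (ha.1 i) (hb.1 j),
    fun i => by rw [← Finset.mul_sum, hb.2, mul_one],
    fun j => by rw [← Finset.sum_mul, ha.2, one_mul]⟩

theorem coupling_sum {a b : Fin n → ℝ} (ha : a ∈ simplex n) {X : Mat n} (hX : X ∈ couplings a b) :
    ∑ i, ∑ j, X i j = 1 := by
  simp only [hX.2.1, ha.2]

/-- Optimal transportation plans exist. -/
theorem exists_isOptimalPlan (C : Mat n) {a b : Fin n → ℝ} (ha : a ∈ simplex n)
    (hb : b ∈ simplex n) : ∃ X, IsOptimalPlan C a b X := by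
  have hclosed : IsClosed (couplings a b) := by
    simp only [couplings, ofPred_and, ofPred_forall]
    refine (isClosed_iInter fun i => isClosed_iInter fun j => isClosed_le (by fun_prop)
      (by fun_prop)).inter ((isClosed_iInter fun i => isClosed_eq (by fun_prop) (by fun_prop)).inter
      (isClosed_iInter fun i => isClosed_eq (by fun_prop) (by fun_prop)))
  obtain ⟨Z, hZ⟩ := couplings_nonempty ha hb
  obtain ⟨X, hX, hmin⟩ := exists_isMinOn_of_sublevel_bounded hclosed
    (F := frob C) (by unfold frob; fun_prop) hZ (lo := 0) (hi := fun i _ => a i) fun Y hY _ =>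
      ⟨fun i j => hY.1 i j, fun i j => (Finset.single_le_sum (f := fun j => Y i j)
        (fun j _ => hY.1 i j) (Finset.mem_univ j)).trans_eq (hY.2.1 i)⟩
  exact ⟨X, hX, fun Z hZ => hmin hZ⟩

theorem frob_nonneg {C X : Mat n} (hC : ∀ i j, 0 ≤ C i j) (hX : ∀ i j, 0 ≤ X i j) : 0 ≤ frob C X :=
  Finset.sum_nonneg fun i _ => Finset.sum_nonneg fun j _ => mul_nonneg (hC i j) (hX i j)

theorem frob_coupling_le (C : Mat n) {a b : Fin n → ℝ} (ha : a ∈ simplex n) {X : Mat n}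
    (hX : X ∈ couplings a b) : frob C X ≤ normInf C := by
  rw [← mul_one (normInf C), ← coupling_sum ha hX]
  simp only [Finset.mul_sum]
  exact Finset.sum_le_sum fun i _ => Finset.sum_le_sum fun j _ =>
    mul_le_mul_of_nonneg_right (le_normInf C i j) (hX.1 i j)

theorem frob_le_add (C X Y : Mat n) :
    frob C X ≤ frob C Y + normInf C * ∑ i, ∑ j, |X i j - Y i j| := by
  simp only [frob, Finset.mul_sum, ← Finset.sum_add_distrib]
  refine Finset.sum_le_sum fun i _ => Finset.sum_le_sum fun j _ => ?_
  have h1 := abs_nonneg (X i j - Y i j)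
  have h2 : C i j * (X i j - Y i j) ≤ normInf C * |X i j - Y i j| := by
    refine (le_abs_self _).trans ?_
    rw [abs_mul]
    refine mul_le_mul_of_nonneg_right ?_ h1
    exact (le_ciSup (Set.finite_range fun j => |C i j|).bddAbove j).trans <|
      le_ciSup (f := fun i => ⨆ j, |C i j|) (Set.finite_range _).bddAbove i
  linarith

theorem row_defect_le (X Y : Mat n) (a : Fin n → ℝ) :
    ∑ i, |∑ j, X i j - a i| ≤ ∑ i, |∑ j, Y i j - a i| + ∑ i, ∑ j, |X i j - Y i j| := by
  rw [← Finset.sum_add_distrib]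
  refine Finset.sum_le_sum fun i _ => ?_
  have h1 : ∑ j, X i j - a i = (∑ j, Y i j - a i) + ∑ j, (X i j - Y i j) := by
    rw [Finset.sum_sub_distrib]; ring
  rw [h1]
  exact (abs_add_le _ _).trans (add_le_add le_rfl (Finset.abs_sum_le_sum_abs _ _))

theorem col_defect_le (X Y : Mat n) (b : Fin n → ℝ) :
    ∑ j, |∑ i, X i j - b j| ≤ ∑ j, |∑ i, Y i j - b j| + ∑ i, ∑ j, |X i j - Y i j| := by
  rw [Finset.sum_comm (f := fun i j => |X i j - Y i j|)]
  exact row_defect_le (fun j i => X i j) (fun j i => Y i j) b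

/-- Entries of a vector with multiplicative error `e ^ (- r / τ)`. -/
theorem sum_defect_le {p r : Fin n → ℝ} (hp : p ∈ simplex n) {κ : ℝ}
    (hκ : κ ≤ 1) (hr : ∀ i, |r i| ≤ κ) : ∑ i, |p i * Real.exp (-r i) - p i| ≤ 2 * κ := by
  have h : ∀ i, |p i * Real.exp (-r i) - p i| ≤ 2 * κ * p i := fun i => by
    have h1 : |Real.exp (-r i) - 1| ≤ 2 * |-r i| := Real.abs_exp_sub_one_le (by
      rw [abs_neg]; exact (hr i).trans hκ)
    have h2 : p i * Real.exp (-r i) - p i = p i * (Real.exp (-r i) - 1) := by ring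
    rw [abs_neg] at h1
    rw [h2, abs_mul, abs_of_nonneg (hp.1 i)]
    nlinarith [hr i, hp.1 i]
  refine (Finset.sum_le_sum fun i _ => h i).trans_eq ?_
  rw [← Finset.mul_sum, hp.2, mul_one]

/-! ### From the convergence rate to the accuracy after `K₀` iterations. -/

namespace UOT

variable {P : UOT n}

/-- The argument of the logarithm in `K₀`. -/
def conditioning (P : UOT n) (ε : ℝ) (xs : Var n) : ℝ :=
  4 * (n : ℝ) ^ 2 * Real.sqrt (P.Delta xs / P.mu) / P.η *
    max (P.L₁ / ε) (max (Real.exp (P.D / P.τ) / P.low) (1 / P.mass))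

theorem K₀_eq (P : UOT n) (ε : ℝ) (xs : Var n) :
    P.K₀ ε xs = 4 * (1 + P.root) * Real.log (P.conditioning ε xs) := rfl

/-- The primal matrix computed by `k` iterations of the gradient extrapolation method. -/
def output (c k : ℕ) (P : UOT n) : Mat n :=
  fun i j => (run c P k).acc.2.2 i j / (run c P k).wt / (2 * P.η)

namespace Admissible

theorem normInf_le_L₁ (hP : P.Admissible) : normInf P.C ≤ P.L₁ := by
  have hτ := hP.τ_pos
  have hη := hP.η_pos
  have h1 : 0 ≤ ⨆ i, |Real.log (P.a i)| := Real.iSup_nonneg fun _ => abs_nonneg _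
  have h2 : 0 ≤ ⨆ i, |Real.log (P.b i)| := Real.iSup_nonneg fun _ => abs_nonneg _
  rw [L₁, q, hP.mass_eq]
  have : 0 ≤ 2 * P.η * 2 + 2 * P.τ * |Real.log P.p| + 2 * P.τ * |Real.log 2|
    + P.τ * (⨆ i, |Real.log (P.a i)|) + P.τ * (⨆ j, |Real.log (P.b j)|) := by positivity
  linarith

/-- The squared initial gradient is at least `1 / n` by Cauchy–Schwarz, so `Delta ≥ 1 / (n μ)`,
while `μ ≤ 1 / (2η)`. It ensures that the logarithm in `K₀` is positive, so that at least one
iteration is run and the average is meaningful. -/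
theorem two_mul_η_le (hP : P.Admissible) {xs : Var n} (hxs : P.IsDualSolution xs) :
    2 * P.η ≤ n * Real.sqrt (P.Delta xs / P.mu) := by
  have hμ := hP.mu_pos
  have hη := hP.η_pos
  have hn : (1 : ℝ) ≤ n := by exact_mod_cast hP.n_pos
  have h1 : 1 ≤ (n : ℝ) * ∑ i, P.a i ^ 2 := by
    have := sq_sum_le_card_mul_sum_sq (s := Finset.univ) (f := P.a)
    simpa [hP.a_mem.2] using this
  have h2 : 1 ≤ (n : ℝ) * (P.Delta xs * P.mu) := by
    have h3 := (div_le_iff₀ hμ).1 (hP.Delta_ge hxs)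
    have h4 : 0 ≤ ∑ i, P.b i ^ 2 := Finset.sum_nonneg fun i _ => sq_nonneg _
    nlinarith
  have hμη : P.mu * (2 * P.η) ≤ 1 := (le_div_iff₀ (by positivity)).1 (min_le_right _ _)
  have h5 : 1 ≤ (n : ℝ) ^ 2 * (P.Delta xs * P.mu) := by
    have : (0 : ℝ) ≤ n * (P.Delta xs * P.mu) := zero_le_one.trans h2
    nlinarith
  have h6 : (2 * P.η) ^ 2 ≤ (n : ℝ) ^ 2 * (P.Delta xs / P.mu) := by
    have h7 : (P.mu * (2 * P.η)) ^ 2 ≤ 1 := pow_le_one₀ (by positivity) hμη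
    have h8 : (n : ℝ) ^ 2 * (P.Delta xs / P.mu) = (n : ℝ) ^ 2 * (P.Delta xs * P.mu) / P.mu ^ 2 := by
      field_simp
    rw [h8, le_div_iff₀ (by positivity)]
    linarith
  have h9 : (n : ℝ) * Real.sqrt (P.Delta xs / P.mu)
      = Real.sqrt ((n : ℝ) ^ 2 * (P.Delta xs / P.mu)) := by
    rw [Real.sqrt_mul (by positivity), Real.sqrt_sq (by positivity)]
  rw [h9]
  exact Real.le_sqrt_of_sq_le h6

theorem one_lt_conditioning (hP : P.Admissible) {xs : Var n} (hxs : P.IsDualSolution xs) (ε : ℝ) :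
    1 < P.conditioning ε xs := by
  have hη := hP.η_pos
  have hn : (1 : ℝ) ≤ n := by exact_mod_cast hP.n_pos
  have h1 := hP.two_mul_η_le hxs
  have h2 : 8 ≤ 4 * (n : ℝ) ^ 2 * Real.sqrt (P.Delta xs / P.mu) / P.η := by
    rw [le_div_iff₀ hη]
    nlinarith [mul_nonneg (Nat.cast_nonneg (α := ℝ) n) (Real.sqrt_nonneg (P.Delta xs / P.mu))]
  have h3 : (1 / 2 : ℝ) ≤ max (P.L₁ / ε) (max (Real.exp (P.D / P.τ) / P.low) (1 / P.mass)) := by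
    rw [hP.mass_eq]
    exact (le_max_right _ _).trans (le_max_right _ _)
  unfold conditioning
  nlinarith

/-- After `K₀` iterations the output is close to the plan of the dual solution. -/
theorem output_dist (hP : P.Admissible) {xs : Var n} (hxs : P.IsDualSolution xs) {ε : ℝ} (hε : 0 < ε)
    (hN : 0 < normInf P.C) (c : ℕ) {k : ℕ} (hk : P.K₀ ε xs ≤ k) :
    ∑ i, ∑ j, |output c k P i j - P.plan xs i j| ≤ ε / (2 * normInf P.C) := by
  have hη := hP.η_pos
  have hn : (1 : ℝ) ≤ n := by exact_mod_cast hP.n_pos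
  have hs := hP.one_lt_root
  have hA := hP.one_lt_conditioning hxs ε
  have hlog := Real.log_pos hA
  rw [K₀_eq] at hk
  have hk0 : 0 < k := by
    have : (0 : ℝ) < k := lt_of_lt_of_le (by positivity) hk
    exact_mod_cast this
  have h1 := hP.run_average_dist c hxs hk0
  have h2 : ∑ i, ∑ j, |output c k P i j - P.plan xs i j| = 1 / (2 * P.η) *
      ∑ i, ∑ j, |(run c P k).acc.2.2 i j / (run c P k).wt - xs.2.2 i j| := by
    simp only [Finset.mul_sum]
    refine Finset.sum_congr rfl fun i _ => Finset.sum_congr rfl fun j _ => ?_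
    rw [output, plan, ← sub_div, abs_div, abs_of_pos (show 0 < 2 * P.η by positivity)]
    ring
  have h3 : Real.sqrt (P.root / (1 + P.root)) ≤ Real.exp (-1 / (1 + P.root) / 2) := by
    rw [Real.exp_half]
    refine Real.sqrt_le_sqrt ?_
    have h4 := Real.add_one_le_exp (-1 / (1 + P.root))
    have h5 : P.root / (1 + P.root) = -1 / (1 + P.root) + 1 := by field_simp; ring
    rw [h5]
    exact h4
  -- The rate is at most `exp (-1 / (2(1+s)))` per iteration; the factor `4` in `K₀` is twice what
  -- this needs.
  have h4 : Real.sqrt (P.root / (1 + P.root)) ^ k ≤ (P.conditioning ε xs)⁻¹ := by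
    refine (pow_le_pow_left₀ (Real.sqrt_nonneg _) h3 k).trans ?_
    rw [← Real.exp_nat_mul, ← Real.exp_log (zero_lt_one.trans hA), ← Real.exp_neg, Real.exp_le_exp]
    have h5 : (k : ℝ) * (-1 / (1 + P.root) / 2) = -(k / (2 * (1 + P.root))) := by field_simp
    rw [h5, neg_le_neg_iff, le_div_iff₀ (by positivity)]
    nlinarith
  set S := Real.sqrt (P.Delta xs / P.mu) with hS
  have hS0 : 0 < S := by
    have := hP.two_mul_η_le hxs
    exact pos_of_mul_pos_right (lt_of_lt_of_le (by positivity) this) (by positivity)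
  have h5 := h1.trans (mul_le_mul_of_nonneg_left h4 (by positivity))
  rw [h2]
  refine (mul_le_mul_of_nonneg_left h5 (by positivity)).trans ?_
  have hmx : normInf P.C / ε ≤ max (P.L₁ / ε) (max (Real.exp (P.D / P.τ) / P.low) (1 / P.mass)) :=
    (div_le_div_of_nonneg_right hP.normInf_le_L₁ hε.le).trans (le_max_left _ _)
  rw [conditioning, ← hS]
  generalize max (P.L₁ / ε) (max (Real.exp (P.D / P.τ) / P.low) (1 / P.mass)) = mx at *
  have hmx0 : 0 < mx := (div_pos hN hε).trans_le hmx
  -- The prefactors of `conditioning` are chosen to cancel those of the distance bound, leaving only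
  -- the maximum, which is at least `‖C‖ / ε`.
  have e : 1 / (2 * P.η) * (4 * n * S * (4 * (n : ℝ) ^ 2 * S / P.η * mx)⁻¹) = 1 / (2 * n * mx) := by
    field_simp
  rw [e, div_le_div_iff₀ (by positivity) (by positivity)]
  have h6 := (div_le_iff₀ hε).1 hmx
  have h7 : mx * ε ≤ n * (mx * ε) := le_mul_of_one_le_left (by positivity) hn
  linarith

end Admissible

end UOT

/-! ### Accuracy with the tuned parameters. -/

open UOT

section Tuned

variable (C : Mat n) (a b : Fin n → ℝ) (ε : ℝ)

theorem tuned_C : (tuned C a b ε).C = C := rfl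

theorem tuned_η' : (tuned C a b ε).η = ε / 16 / 2 := rfl

theorem tuned_η : (tuned C a b ε).η = ε / 32 := by rw [tuned_η']; ring

theorem tuned_τ' : (tuned C a b ε).τ =
    16 * normInf C * n * (normInf C + (tuned C a b ε).η) / ε := rfl

theorem tuned_τ : (tuned C a b ε).τ = 16 * normInf C * n * (normInf C + ε / 32) / ε := by
  rw [tuned_τ', tuned_η]

theorem gemOT_val (c k : ℕ) :
    (gemOT c k C a b ε).val = (proj (output c k (tuned C a b ε)) a b).val := rfl

end Tuned

variable {C : Mat n} {a b : Fin n → ℝ} {ε : ℝ}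

theorem tuned_admissible (hC : ∀ i j, 0 ≤ C i j) (hC0 : C ≠ 0) (ha : a ∈ simplex n)
    (hb : b ∈ simplex n) (ha0 : 0 < minEntry a) (hb0 : 0 < minEntry b) (hε : 0 < ε) :
    (tuned C a b ε).Admissible where
  C_nonneg := hC
  a_mem := ha
  b_mem := hb
  a_pos := ha0
  b_pos := hb0
  τ_pos := by
    have h1 := normInf_pos hC hC0
    have h2 : 0 < n := by
      rcases Nat.eq_zero_or_pos n with rfl | h
      · simpa using ha.2
      · exact h
    rw [tuned_τ]
    positivity
  η_pos := by rw [tuned_η]; positivity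

/-- With at least `K₀` iterations the method returns an `ε`-approximate plan. -/
theorem gemOT_isApproxPlan (hC : ∀ i j, 0 ≤ C i j) (hC0 : C ≠ 0) (ha : a ∈ simplex n)
    (hb : b ∈ simplex n) (ha0 : 0 < minEntry a) (hb0 : 0 < minEntry b) (hε : 0 < ε) {xs : Var n}
    (hxs : (tuned C a b ε).IsDualSolution xs) (c : ℕ) {k : ℕ}
    (hk : (tuned C a b ε).K₀ (ε / 16) xs ≤ k) : IsApproxPlan C a b ε (gemOT c k C a b ε).val := by
  have hP := tuned_admissible hC hC0 ha hb ha0 hb0 hε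
  have hN := normInf_pos hC hC0
  have hn : (1 : ℝ) ≤ n := by exact_mod_cast hP.n_pos
  have hη := tuned_η C a b ε
  have hτ := tuned_τ C a b ε
  have hdist := hP.output_dist hxs (show 0 < ε / 16 by positivity) hN c hk
  rw [tuned_C] at hdist
  have hkkt := hP.isKKT hxs
  obtain ⟨X, hX⟩ := exists_isOptimalPlan C ha hb
  rw [gemOT_val]
  set P := tuned C a b ε
  set O := output c k P
  have hO : ∀ i j, 0 ≤ O i j := fun i j =>
    div_nonneg (div_nonneg (hP.run_acc_nonneg c k i j) (hP.run_wt_pos c k).2.1)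
      (by have := hP.η_pos; positivity)
  obtain ⟨hY, hYc⟩ := proj_spec hC hO ha hb
  refine ⟨hY, X, hX, ?_⟩
  have hX0 := frob_nonneg hC hX.1.1
  -- If `‖C‖ ≤ ε`, every coupling is good enough; otherwise the exponents below are at most one, as
  -- the linear estimate of `exp` requires.
  rcases le_or_gt (normInf C) ε with hle | hlt
  · have := frob_coupling_le C ha hY
    linarith
  have hκ : (normInf C + 2 * P.η) / P.τ ≤ ε / (8 * normInf C) := by
    rw [div_le_div_iff₀ hP.τ_pos (by positivity), hτ, hη]
    have e : ε * (16 * normInf C * n * (normInf C + ε / 32) / ε)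
        = 16 * normInf C * (n * (normInf C + ε / 32)) := by field_simp
    rw [e]
    have : normInf C + ε / 32 ≤ n * (normInf C + ε / 32) := le_mul_of_one_le_left (by positivity) hn
    nlinarith
  have hκ1 : ε / (8 * normInf C) ≤ 1 := by rw [div_le_one (by positivity)]; linarith
  have hdiv : ∀ r, |r| ≤ normInf C + 2 * P.η → |r / P.τ| ≤ ε / (8 * normInf C) := fun r hr => by
    rw [abs_div, abs_of_pos hP.τ_pos]
    exact (div_le_div_of_nonneg_right hr hP.τ_pos.le).trans hκ
  have hrow : ∑ i, |∑ j, P.plan xs i j - a i| ≤ 2 * (ε / (8 * normInf C)) := by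
    simp only [hkkt.plan_row]
    exact sum_defect_le ha hκ1 fun i => hdiv _ (hkkt.abs_u_le hP i)
  have hcol : ∑ j, |∑ i, P.plan xs i j - b j| ≤ 2 * (ε / (8 * normInf C)) := by
    simp only [hkkt.plan_col]
    exact sum_defect_le hb hκ1 fun i => hdiv _ (hkkt.abs_v_le hP i)
  have h1 := row_defect_le O (P.plan xs) a
  have h2 := col_defect_le O (P.plan xs) b
  have h3 := frob_le_add C O (P.plan xs)
  have h4 : frob C (P.plan xs) ≤ frob C X + P.η / 2 := hkkt.frob_plan_le hP hX.1
  have h5 := mul_le_mul_of_nonneg_left (add_le_add (h1.trans (add_le_add hrow hdist))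
    (h2.trans (add_le_add hcol hdist))) hN.le
  have h6 := mul_le_mul_of_nonneg_left hdist hN.le
  -- Error budget: `9ε/16` for the rounding, `ε/32` for the distance to the dual plan, and `η/2 =
  -- ε/64` for the regularisation.
  have e1 : normInf C * (2 * (ε / (8 * normInf C)) + ε / 16 / (2 * normInf C)
      + (2 * (ε / (8 * normInf C)) + ε / 16 / (2 * normInf C))) = 9 / 16 * ε := by
    field_simp; norm_num
  have e2 : normInf C * (ε / 16 / (2 * normInf C)) = ε / 32 := by field_simp; norm_num
  rw [e1] at h5
  rw [e2] at h6
  rw [hη] at h4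
  linarith

/-! ### Exact step counts. -/

namespace Timed

variable {β γ : Type}

theorem steps_bind (p : Timed β) (f : β → Timed γ) : (p >>= f).steps = p.steps + (f p.val).steps :=
  rfl

theorem steps_pure (x : β) : (pure x : Timed β).steps = 0 := rfl

theorem steps_rd (x : ℝ) : (rd x).steps = 0 := rfl

theorem steps_one : (1 : Timed ℝ).steps = 0 := rfl

theorem steps_two : (2 : Timed ℝ).steps = 0 := rfl

theorem steps_sixteen : (16 : Timed ℝ).steps = 0 := rfl

theorem steps_add (p q : Timed ℝ) : (p + q).steps = p.steps + q.steps + 1 := rfl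

theorem steps_sub (p q : Timed ℝ) : (p - q).steps = p.steps + q.steps + 1 := rfl

theorem steps_mul (p q : Timed ℝ) : (p * q).steps = p.steps + q.steps + 1 := rfl

theorem steps_div (p q : Timed ℝ) : (p / q).steps = p.steps + q.steps + 1 := rfl

theorem steps_neg (p : Timed ℝ) : (-p).steps = p.steps + 1 := rfl

theorem steps_tmin (p q : Timed ℝ) : (tmin p q).steps = p.steps + q.steps + 1 := rfl

theorem steps_tabs (p : Timed ℝ) : (tabs p).steps = p.steps + 1 := rfl

theorem steps_texp (p : Timed ℝ) : (texp p).steps = p.steps + 1 := rfl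

theorem steps_tlog (p : Timed ℝ) : (tlog p).steps = p.steps + 1 := rfl

theorem steps_tsqrt (p : Timed ℝ) : (tsqrt p).steps = p.steps + 1 := rfl

theorem steps_tab (f : Fin n → Timed β) : (tab f).steps = ∑ i, (f i).steps := rfl

theorem steps_sumT (f : Fin n → Timed ℝ) : (sumT f).steps = ∑ i, ((f i).steps + 1) := rfl

theorem steps_minT (f : Fin n → Timed ℝ) : (minT f).steps = ∑ i, ((f i).steps + 1) := rfl

theorem steps_maxT (f : Fin n → Timed ℝ) : (maxT f).steps = ∑ i, ((f i).steps + 1) := rfl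

/-- A loop body of constant cost. -/
theorem steps_loop {f : β → Timed β} {B : ℕ} (hf : ∀ s, (f s).steps = B) (k : ℕ) (s : β) :
    (loop f k s).steps = k * B := by
  induction k with
  | zero => rw [zero_mul]; rfl
  | succ k ih =>
    have : (loop f (k + 1) s).steps = (loop f k s).steps + (f (loop f k s).val).steps := rfl
    rw [this, ih, hf]; ring

end Timed

open Timed

theorem steps_normProg (C : Mat n) : (normProg C).steps = 2 * n ^ 2 + n := by
  simp only [normProg, steps_maxT, steps_tabs, steps_rd, Finset.sum_const, Finset.card_univ,
    Fintype.card_fin, smul_eq_mul]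
  ring

theorem steps_constsProg (P : UOT n) : (constsProg P).steps = 2 * n ^ 2 + 5 * n + 37 := by
  simp only [constsProg, steps_bind, steps_pure, steps_rd, steps_one, steps_two, steps_sixteen, steps_add, steps_sub,
    steps_mul, steps_div, steps_neg, steps_tmin, steps_texp, steps_tlog, steps_tsqrt, steps_sumT,
    steps_minT, steps_normProg, Finset.sum_const, Finset.card_univ, Fintype.card_fin, smul_eq_mul]
  ring

theorem steps_combine {g : ℝ → ℝ → Timed ℝ} {B : ℕ} (hg : ∀ p q, (g p q).steps = B) (x y : Var n) :
    (combine g x y).steps = B * (n ^ 2 + 2 * n) := by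
  simp only [combine, steps_bind, steps_pure, steps_tab, hg, Finset.sum_const, Finset.card_univ,
    Fintype.card_fin, smul_eq_mul]
  ring

theorem steps_gradProg (P : UOT n) (K : Consts) (x : Var n) :
    (gradProg P K x).steps = 14 * n := by
  simp only [gradProg, steps_bind, steps_pure, steps_tab, steps_rd, steps_sub, steps_mul, steps_div,
    steps_neg, steps_texp, Finset.sum_const, Finset.card_univ, Fintype.card_fin, smul_eq_mul]
  ring

theorem steps_iteration (c : ℕ) (P : UOT n) (K : Consts) (s : State n) :
    (iteration c P K s).steps = (c + 9) * (n ^ 2 + 2 * n) + 14 * n + 2 := by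
  have h1 : ∀ p q, (rd p + rd K.α * (rd p - rd q)).steps = 3 := fun p q => rfl
  have h2 : ∀ p q, ((rd p + rd K.ψ * rd q) / (1 + rd K.ψ)).steps = 4 := fun p q => rfl
  have h3 : ∀ θ p q, (rd p + rd θ * rd q).steps = 2 := fun θ p q => rfl
  simp only [iteration, steps_bind, steps_pure, steps_combine h1, steps_combine h2,
    steps_combine (h3 _), proxOracle, steps_gradProg, steps_div, steps_add, steps_rd]
  ring

theorem steps_proj (X : Mat n) (a b : Fin n → ℝ) : (proj X a b).steps = 9 * n ^ 2 + 8 * n := by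
  simp only [proj, steps_bind, steps_tab, steps_sumT, steps_rd, steps_sub, steps_mul, steps_div,
    steps_add, steps_tmin, steps_tabs, steps_one, Finset.sum_const, Finset.card_univ,
    Fintype.card_fin, smul_eq_mul]
  ring

theorem steps_tunedProg (C : Mat n) (a b : Fin n → ℝ) (ε : ℝ) :
    (tunedProg C a b ε).steps = 2 * n ^ 2 + n + 7 := by
  simp only [tunedProg, steps_bind, steps_pure, steps_normProg, steps_rd, steps_mul, steps_div,
    steps_add, steps_two, steps_sixteen]
  ring

theorem steps_gemUOT (c k : ℕ) (P : UOT n) : (gemUOT c k P).steps =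
    2 * n ^ 2 + 5 * n + 37 + k * ((c + 9) * (n ^ 2 + 2 * n) + 14 * n + 2) + 3 * n ^ 2 := by
  simp only [gemUOT, steps_bind, steps_constsProg, steps_loop (steps_iteration c P _), steps_tab,
    steps_div, steps_mul, steps_rd, steps_two, Finset.sum_const, Finset.card_univ,
    Fintype.card_fin, smul_eq_mul]
  ring

/-- The step count of the method, for at least two points. -/
theorem steps_gemOT_le (hn : 2 ≤ n) (c k : ℕ) (C : Mat n) (a b : Fin n → ℝ) (ε : ℝ) :
    (gemOT c k C a b ε).steps ≤ (37 + k * (2 * c + 26)) * n ^ 2 := by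
  have h : (gemOT c k C a b ε).steps = (tunedProg C a b ε).steps
    + ((gemUOT c k (tuned C a b ε)).steps + (proj (gemUOT c k (tuned C a b ε)).val a b).steps) := rfl
  rw [h, steps_tunedProg, steps_gemUOT, steps_proj]
  have h1 : 2 * n ≤ n ^ 2 := by nlinarith
  have h2 : (c + 9) * (n ^ 2 + 2 * n) + 14 * n + 2 ≤ (2 * c + 26) * n ^ 2 := by nlinarith
  have h3 := Nat.mul_le_mul_left k h2
  nlinarith

/-! ### The size of the iteration number. -/

namespace UOT

variable {P : UOT n}

/-- The parameters are in the regime produced by the tuning: `T` bounds the size of the problem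
and the inverse relative accuracy. -/
structure IsTuned (P : UOT n) (T ε : ℝ) : Prop extends P.Admissible where
  ε_pos : 0 < ε
  η_eq : P.η = ε / 32
  normInf_le : normInf P.C ≤ T * ε
  le_normInf : ε ≤ normInf P.C
  two_le : 2 ≤ T
  n_le : n ≤ T
  τ_eq : P.τ = 16 * T * (normInf P.C + ε / 32)

namespace IsTuned

variable {T ε : ℝ}

theorem normInf_le_τ (hP : P.IsTuned T ε) : 16 * (T * normInf P.C) ≤ P.τ := by
  have := hP.ε_pos
  have := hP.two_le
  have : 0 ≤ T * ε := by positivity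
  rw [hP.τ_eq]; nlinarith

theorem τ_le (hP : P.IsTuned T ε) : P.τ ≤ 17 * T ^ 2 * ε := by
  have h1 := hP.ε_pos
  have h2 := hP.two_le
  have h3 : normInf P.C + ε / 32 ≤ 17 / 16 * (T * ε) := by
    have := hP.normInf_le
    nlinarith
  rw [hP.τ_eq]
  have := mul_le_mul_of_nonneg_left h3 (show 0 ≤ 16 * T by linarith)
  linarith

theorem normInf_pos (hP : P.IsTuned T ε) : 0 < normInf P.C := hP.ε_pos.trans_le hP.le_normInf

theorem inv_low_ge (hP : P.IsTuned T ε) : 1 ≤ P.low⁻¹ :=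
  (one_le_inv₀ hP.low_pos).2 hP.low_le_one

/-- `τ` dominates the range of the potentials, so `exp_width_le` can replace the remaining
exponential factor by a numerical constant. -/
theorem width_le (hP : P.IsTuned T ε) : normInf P.C + 2 * P.η ≤ P.τ := by
  have h1 := hP.normInf_le_τ
  have h2 := hP.le_normInf
  have h3 := hP.η_eq
  have h4 := hP.two_le
  have h5 := hP.normInf_pos
  nlinarith

theorem exp_width_le (hP : P.IsTuned T ε) :
    Real.exp ((normInf P.C + 2 * P.η) / P.τ) ≤ 3 := by
  have h1 : (normInf P.C + 2 * P.η) / P.τ ≤ 1 := (div_le_one hP.τ_pos).2 hP.width_le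
  have h2 := Real.exp_one_lt_d9
  have h3 := Real.exp_le_exp.2 h1
  linarith

theorem modulus_inv (hP : P.IsTuned T ε) :
    P.modulus⁻¹ = P.τ * P.low⁻¹ ^ 2 * Real.exp ((normInf P.C + 2 * P.η) / P.τ) := by
  have h1 := hP.low_pos
  have h2 := hP.τ_pos
  rw [modulus, hP.exp_neg_D, Real.exp_neg]
  field_simp

theorem modulus_le (hP : P.IsTuned T ε) : P.modulus ≤ 1 / P.τ := by
  have h1 := hP.low_pos
  have h2 := hP.τ_pos
  rw [modulus, div_mul_eq_mul_div]
  refine div_le_div_of_nonneg_right ?_ h2.le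
  exact mul_le_one₀ hP.low_le_one (Real.exp_pos _).le
    (Real.exp_le_one_iff.2 (neg_nonpos.2 (div_nonneg hP.D_nonneg h2.le)))

theorem mu_inv_le (hP : P.IsTuned T ε) : 1 / P.mu ≤ 4 * (P.τ * P.low⁻¹ ^ 2) := by
  have hτ := hP.τ_pos
  have hk := hP.inv_low_ge
  have hk2 : 1 ≤ P.low⁻¹ ^ 2 := one_le_pow₀ hk
  have h1 : P.modulus⁻¹ ≤ P.τ * P.low⁻¹ ^ 2 * 3 := by
    rw [hP.modulus_inv]
    exact mul_le_mul_of_nonneg_left hP.exp_width_le (by positivity)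
  have h2 : P.τ ≤ P.τ * P.low⁻¹ ^ 2 := le_mul_of_one_le_right hτ.le hk2
  rw [mu]
  rcases min_choice P.modulus (1 / (2 * P.η)) with h | h <;> rw [h]
  · rw [one_div]; linarith
  · rw [one_div_one_div]
    have := hP.width_le
    have := hP.normInf_pos
    linarith

/-- `L ≤ 2 / τ` and `1 / μ ≤ 4 τ κ²`, so `τ` cancels and the rate depends on `κ` alone. The constant
comes from `1 + 16 · 8 κ² ≤ 144 κ²`. -/
theorem root_le (hP : P.IsTuned T ε) : P.root ≤ 12 * P.low⁻¹ := by
  have hτ := hP.τ_pos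
  have hk := hP.inv_low_ge
  have hμ := hP.mu_pos
  have h1 : P.L ≤ 2 / P.τ := by
    have := hP.modulus_le
    rw [hP.L_eq, show 2 / P.τ = 1 / P.τ + 1 / P.τ by ring]
    linarith
  have h2 : P.L / P.mu ≤ 8 * P.low⁻¹ ^ 2 := by
    calc P.L / P.mu = P.L * (1 / P.mu) := by ring
      _ ≤ 2 / P.τ * (4 * (P.τ * P.low⁻¹ ^ 2)) :=
        mul_le_mul h1 hP.mu_inv_le (by positivity) (by positivity)
      _ = _ := by field_simp; norm_num
  refine Real.sqrt_le_iff.2 ⟨by positivity, ?_⟩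
  rw [mul_div_assoc]
  nlinarith [one_le_pow₀ hk (n := 2)]

/-- The prox term is at most `τ`, `h 0` equals `2τ` and `h xs` is nonnegative; the gradient term `2
/ μ` contributes the remaining `8 τ κ²`. -/
theorem Delta_le (hP : P.IsTuned T ε) {xs : Var n} (hxs : P.IsDualSolution xs) :
    P.Delta xs ≤ 11 * (P.τ * P.low⁻¹ ^ 2) := by
  have hτ := hP.τ_pos
  have hη := hP.η_pos
  have hμ := hP.mu_pos
  have hN := hP.normInf_pos
  have hkkt := hP.isKKT hxs
  set ω := normInf P.C + 2 * P.η with hω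
  have hω0 : 0 ≤ ω := by positivity
  have hsq : ∀ r : ℝ, |r| ≤ ω → r ^ 2 ≤ ω ^ 2 := fun r hr => sq_le_sq' (abs_le.1 hr).1 (abs_le.1 hr).2
  have hu : ∑ i, xs.1 i ^ 2 ≤ n * ω ^ 2 := by
    have := Finset.sum_le_sum fun i (_ : i ∈ Finset.univ) => hsq _ (hkkt.abs_u_le hP.toAdmissible i)
    simpa using this
  have hv : ∑ i, xs.2.1 i ^ 2 ≤ n * ω ^ 2 := by
    have := Finset.sum_le_sum fun i (_ : i ∈ Finset.univ) => hsq _ (hkkt.abs_v_le hP.toAdmissible i)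
    simpa using this
  have ht : 1 / (2 * P.η) * ∑ i, ∑ j, xs.2.2 i j ^ 2 ≤ 2 * P.η := by
    have h1 : 1 / (2 * P.η) * ∑ i, ∑ j, xs.2.2 i j ^ 2
        = 2 * P.η * ∑ i, ∑ j, P.plan xs i j ^ 2 := by
      simp only [Finset.mul_sum]
      refine Finset.sum_congr rfl fun i _ => Finset.sum_congr rfl fun j _ => ?_
      rw [plan]; field_simp
    have h2 : ∑ i, ∑ j, P.plan xs i j ^ 2 ≤ ∑ i, ∑ j, P.plan xs i j :=
      Finset.sum_le_sum fun i _ => Finset.sum_le_sum fun j _ => by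
        have h3 := hkkt.plan_nonneg hP.toAdmissible i j
        have h4 := hkkt.plan_le_one hP.toAdmissible i j
        nlinarith
    rw [h1]
    exact mul_le_of_le_one_right (by positivity) (h2.trans (hkkt.mass_le_one hP.toAdmissible))
  -- One factor `ω` is absorbed because `ω ≤ τ` and `modulus ≤ 1 / τ`.
  have hnω : P.modulus * (n * ω ^ 2) ≤ n * ω := by
    have h1 : P.modulus * ω ≤ 1 := by
      have := mul_le_mul hP.modulus_le hP.width_le hω0 (by positivity)
      rwa [one_div_mul_cancel hτ.ne'] at this
    calc P.modulus * (n * ω ^ 2) = P.modulus * ω * (n * ω) := by ring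
      _ ≤ 1 * (n * ω) := mul_le_mul_of_nonneg_right h1 (by positivity)
      _ = _ := one_mul _
  have hhess : P.hess xs xs ≤ 2 * (n * ω) + 2 * P.η := by
    rw [hess_self]
    have := mul_le_mul_of_nonneg_left (add_le_add hu hv) hP.modulus_pos.le
    linarith
  have hh : 0 ≤ P.h xs := by
    have h1 : 0 ≤ ∑ i, Real.exp (-(xs.1 i / P.τ)) * P.a i :=
      Finset.sum_nonneg fun i _ => mul_nonneg (Real.exp_pos _).le (hP.a_mem.1 i)
    have h2 : 0 ≤ ∑ i, Real.exp (-(xs.2.1 i / P.τ)) * P.b i :=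
      Finset.sum_nonneg fun i _ => mul_nonneg (Real.exp_pos _).le (hP.b_mem.1 i)
    rw [h]; positivity
  have hh0 : P.h 0 = 2 * P.τ := by
    simp [h, hP.a_mem.2, hP.b_mem.2]; ring
  have hg : dot (P.gradF 0) (P.gradF 0) ≤ 2 := by
    have h1 : ∑ i, P.a i ^ 2 ≤ ∑ i, P.a i := Finset.sum_le_sum fun i _ => by
      nlinarith [hP.a_mem.1 i, hP.a_le_one i]
    have h2 : ∑ i, P.b i ^ 2 ≤ ∑ i, P.b i := Finset.sum_le_sum fun i _ => by
      nlinarith [hP.b_mem.1 i, hP.b_le_one i]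
    rw [hP.a_mem.2] at h1
    rw [hP.b_mem.2] at h2
    rw [Admissible.dot_gradF_zero]; linarith
  have hgμ : dot (P.gradF 0) (P.gradF 0) / P.mu ≤ 2 * (4 * (P.τ * P.low⁻¹ ^ 2)) := by
    rw [← mul_one_div]
    exact mul_le_mul hg hP.mu_inv_le (by positivity) (by norm_num)
  have hk2 : 1 ≤ P.low⁻¹ ^ 2 := one_le_pow₀ hP.inv_low_ge
  have hτk : P.τ ≤ P.τ * P.low⁻¹ ^ 2 := le_mul_of_one_le_right hτ.le hk2
  have hsmall : n * ω + P.η ≤ P.τ := by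
    have h1 := hP.normInf_le_τ
    have h2 := hP.le_normInf
    have h3 := hP.η_eq
    have h4 := hP.two_le
    have h5 : n * ω ≤ T * ω := mul_le_mul_of_nonneg_right hP.n_le hω0
    have h6 : ω ≤ 2 * normInf P.C := by rw [hω, h3]; linarith
    have h7 := mul_le_mul_of_nonneg_left h6 (show 0 ≤ T by linarith)
    nlinarith
  rw [Delta, bregman_eq, sub_zero, mul_div_cancel₀ _ hμ.ne', hh0]
  linarith

theorem sqrt_Delta_le (hP : P.IsTuned T ε) {xs : Var n} (hxs : P.IsDualSolution xs) :
    Real.sqrt (P.Delta xs / P.mu) ≤ 7 * (P.τ * P.low⁻¹ ^ 2) := by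
  have hτ := hP.τ_pos
  have hk := hP.inv_low_ge
  have hμ := hP.mu_pos
  have h0 : 0 ≤ P.τ * P.low⁻¹ ^ 2 := by positivity
  refine Real.sqrt_le_iff.2 ⟨by positivity, ?_⟩
  have h1 : P.Delta xs / P.mu ≤ 11 * (P.τ * P.low⁻¹ ^ 2) * (4 * (P.τ * P.low⁻¹ ^ 2)) := by
    rw [← mul_one_div]
    exact mul_le_mul (hP.Delta_le hxs) hP.mu_inv_le (by positivity) (by positivity)
  nlinarith

theorem log_inv_low_le (hP : P.IsTuned T ε) : -Real.log P.low ≤ P.low⁻¹ := by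
  rw [← Real.log_inv]
  have := Real.log_le_sub_one_of_pos (inv_pos.2 hP.low_pos)
  linarith

theorem iSup_abs_log_le {p : Fin n → ℝ} {l : ℝ} (hl : 0 < l) (hp : ∀ i, l ≤ p i)
    (hp1 : ∀ i, p i ≤ 1) (h : 0 ≤ -Real.log l) : ⨆ i, |Real.log (p i)| ≤ -Real.log l :=
  Real.iSup_le (fun i => by
    rw [abs_of_nonpos (Real.log_nonpos (hl.trans_le (hp i)).le (hp1 i))]
    exact neg_le_neg (Real.log_le_log hl (hp i))) h

theorem L₁_le (hP : P.IsTuned T ε) : P.L₁ ≤ 13 * (P.τ * P.low⁻¹) := by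
  have hτ := hP.τ_pos
  have hlow := hP.low_pos
  have hk := hP.inv_low_ge
  have hlog := hP.log_inv_low_le
  have hlog0 : 0 ≤ -Real.log P.low := neg_nonneg.2 hP.log_low_nonpos
  have hla := iSup_abs_log_le hlow P.low_le_a hP.a_le_one hlog0
  have hlb := iSup_abs_log_le hlow P.low_le_b hP.b_le_one hlog0
  have h2 : |Real.log 2| ≤ 1 := by
    rw [abs_of_nonneg (Real.log_nonneg one_le_two)]
    linarith [Real.log_two_lt_d9]
  have hω : (normInf P.C + 2 * P.η) / P.τ ≤ 1 := (div_le_one hτ).2 hP.width_le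
  have hω0 : 0 ≤ (normInf P.C + 2 * P.η) / P.τ :=
    div_nonneg (add_nonneg hP.normInf_pos.le (by have := hP.η_pos; positivity)) hτ.le
  have hlp : |Real.log P.p| ≤ 4 * P.low⁻¹ := by
    have e : Real.log P.p = -Real.log 2 + Real.log P.low + (Real.log P.low
        - (normInf P.C + 2 * P.η) / P.τ) := by
      rw [p, Real.log_mul (by positivity) (Real.exp_pos _).ne', Real.log_mul (by norm_num) hlow.ne',
        Real.log_exp, hP.neg_D_div, one_div, Real.log_inv]
    have := Real.log_nonneg one_le_two
    have := (abs_le.1 h2).2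
    rw [e, abs_le]
    constructor <;> linarith
  have h3 : normInf P.C + 2 * P.η * 2 ≤ P.τ := by
    have h1 := hP.normInf_le_τ
    have h2 := hP.le_normInf
    have h3 := hP.η_eq
    have h4 := hP.two_le
    have h5 := hP.normInf_pos
    nlinarith
  have e1 := mul_le_mul_of_nonneg_left hlp (show 0 ≤ 2 * P.τ by positivity)
  have e2 := mul_le_mul_of_nonneg_left h2 (show 0 ≤ 2 * P.τ by positivity)
  have e3 := mul_le_mul_of_nonneg_left (hla.trans hlog) hτ.le
  have e4 := mul_le_mul_of_nonneg_left (hlb.trans hlog) hτ.le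
  have e5 : P.τ ≤ P.τ * P.low⁻¹ := le_mul_of_one_le_right hτ.le hk
  rw [L₁, q, hP.mass_eq]
  linarith

/-- Every length is at most a multiple of `τ` times a power of `κ`, and `τ / ε ≤ 17 T²`, so only
powers of `T` and `κ` survive. -/
theorem conditioning_le (hP : P.IsTuned T ε) {xs : Var n} (hxs : P.IsDualSolution xs) :
    P.conditioning (ε / 16) xs ≤ T ^ 32 * P.low⁻¹ ^ 4 := by
  have hτ := hP.τ_pos
  have hε := hP.ε_pos
  have hk := hP.inv_low_ge
  have hlow := hP.low_pos
  have hT := hP.two_le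
  have hT0 : 0 < T := by linarith
  have hτε : P.τ / ε ≤ 17 * T ^ 2 := (div_le_iff₀ hε).2 hP.τ_le
  have hk2 : P.low⁻¹ ≤ P.low⁻¹ ^ 2 := le_self_pow₀ hk two_ne_zero
  have h1 : 4 * (n : ℝ) ^ 2 * Real.sqrt (P.Delta xs / P.mu) / P.η
      ≤ 15232 * T ^ 4 * P.low⁻¹ ^ 2 := by
    have h2 : (n : ℝ) ^ 2 ≤ T ^ 2 := pow_le_pow_left₀ (Nat.cast_nonneg n) hP.n_le 2
    calc 4 * (n : ℝ) ^ 2 * Real.sqrt (P.Delta xs / P.mu) / P.η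
        ≤ 4 * T ^ 2 * (7 * (P.τ * P.low⁻¹ ^ 2)) / P.η := by
          have := hP.sqrt_Delta_le hxs
          have := hP.η_pos
          gcongr
      _ = 896 * T ^ 2 * P.low⁻¹ ^ 2 * (P.τ / ε) := by rw [hP.η_eq]; field_simp; norm_num
      _ ≤ 896 * T ^ 2 * P.low⁻¹ ^ 2 * (17 * T ^ 2) := by gcongr
      _ = _ := by ring
  have hT2 : 1 ≤ T ^ 2 := one_le_pow₀ (by linarith)
  have hk21 : 1 ≤ P.low⁻¹ ^ 2 := one_le_pow₀ hk
  have hTk : 1 * P.low⁻¹ ^ 2 ≤ T ^ 2 * P.low⁻¹ ^ 2 := mul_le_mul_of_nonneg_right hT2 (by positivity)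
  have h3 : max (P.L₁ / (ε / 16)) (max (Real.exp (P.D / P.τ) / P.low) (1 / P.mass))
      ≤ 3536 * T ^ 2 * P.low⁻¹ ^ 2 := by
    refine max_le ?_ (max_le ?_ ?_)
    · calc P.L₁ / (ε / 16) ≤ 13 * (P.τ * P.low⁻¹ ^ 2) / (ε / 16) := by
            have h4 := hP.L₁_le
            have h5 := mul_le_mul_of_nonneg_left hk2 hτ.le
            gcongr
            linarith
        _ = 208 * P.low⁻¹ ^ 2 * (P.τ / ε) := by field_simp; norm_num
        _ ≤ 208 * P.low⁻¹ ^ 2 * (17 * T ^ 2) := by gcongr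
        _ = _ := by ring
    · have e : Real.exp (P.D / P.τ) / P.low
          = P.low⁻¹ ^ 2 * Real.exp ((normInf P.C + 2 * P.η) / P.τ) := by
        have h5 := hP.exp_neg_D
        rw [Real.exp_neg, Real.exp_neg, inv_eq_iff_eq_inv] at h5
        rw [h5]
        field_simp
      rw [e]
      have := mul_le_mul_of_nonneg_left hP.exp_width_le (show 0 ≤ P.low⁻¹ ^ 2 by positivity)
      linarith
    · rw [hP.mass_eq]
      linarith
  -- The numerical constant `15232 · 3536` is below `2²⁶` and is absorbed into powers of `T ≥ 2`, so
  -- that the logarithm is purely a multiple of `log T` and `log κ`.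
  have h4 : (2 : ℝ) ^ 26 ≤ T ^ 26 := pow_le_pow_left₀ (by norm_num) hT 26
  calc P.conditioning (ε / 16) xs ≤ 15232 * T ^ 4 * P.low⁻¹ ^ 2 * (3536 * T ^ 2 * P.low⁻¹ ^ 2) :=
        mul_le_mul h1 h3 (le_trans (by rw [hP.mass_eq]; norm_num)
          ((le_max_right _ _).trans (le_max_right _ _))) (by positivity)
    _ = 53861 * 1000 * (T ^ 6 * P.low⁻¹ ^ 4) - 648 * (T ^ 6 * P.low⁻¹ ^ 4) := by ring
    _ ≤ 2 ^ 26 * (T ^ 6 * P.low⁻¹ ^ 4) := by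
      have : 0 ≤ T ^ 6 * P.low⁻¹ ^ 4 := by positivity
      linarith
    _ ≤ T ^ 26 * (T ^ 6 * P.low⁻¹ ^ 4) := mul_le_mul_of_nonneg_right h4 (by positivity)
    _ = _ := by ring

/-- The iteration number is of order `κ log T`. -/
theorem K₀_le (hP : P.IsTuned T ε) {xs : Var n} (hxs : P.IsDualSolution xs) {d : ℕ}
    (hd : P.low⁻¹ ≤ T ^ d) :
    P.K₀ (ε / 16) xs ≤ 52 * (32 + 4 * d) * (P.low⁻¹ * Real.log T) := by
  have hT := hP.two_le
  have hk := hP.inv_low_ge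
  have hA := hP.one_lt_conditioning hxs (ε / 16)
  have hlogT : 0 ≤ Real.log T := Real.log_nonneg (by linarith)
  have h1 : P.conditioning (ε / 16) xs ≤ T ^ (32 + 4 * d) := by
    refine (hP.conditioning_le hxs).trans ?_
    rw [pow_add, mul_comm 4 d, pow_mul]
    gcongr
  have h2 := Real.log_le_log (zero_lt_one.trans hA) h1
  rw [Real.log_pow] at h2
  push_cast at h2
  have h3 : 4 * (1 + P.root) ≤ 52 * P.low⁻¹ := by
    have := hP.root_le
    linarith
  rw [K₀_eq]
  calc _ ≤ 52 * P.low⁻¹ * ((32 + 4 * d) * Real.log T) :=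
        mul_le_mul h3 h2 (Real.log_pos hA).le (by positivity)
    _ = _ := by ring

end IsTuned

end UOT

theorem tuned_isTuned (hP : (tuned C a b ε).Admissible) (hε : 0 < ε) (hn : 2 ≤ n)
    (hεN : ε ≤ normInf C) : (tuned C a b ε).IsTuned (n * normInf C / ε) ε where
  toAdmissible := hP
  ε_pos := hε
  η_eq := tuned_η C a b ε
  le_normInf := hεN
  normInf_le := by
    rw [tuned_C, div_mul_cancel₀ _ hε.ne']
    have : (1 : ℝ) ≤ n := by exact_mod_cast one_le_two.trans hn
    exact le_mul_of_one_le_left (normInf_nonneg C) this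
  two_le := by
    have : (2 : ℝ) ≤ n := by exact_mod_cast hn
    rw [le_div_iff₀ hε]
    exact mul_le_mul this hεN hε.le (by positivity)
  n_le := by
    rw [le_div_iff₀ hε]
    exact mul_le_mul_of_nonneg_left hεN (Nat.cast_nonneg n)
  τ_eq := by rw [tuned_τ, tuned_C]; ring

/-- Polynomially bounded inverse marginals. -/
theorem inv_low_le_pow {P : UOT n} (hP : P.Admissible) {c₀ : ℝ}
    (ha : |Real.log (minEntry P.a)| ≤ c₀ * Real.log n)
    (hb : |Real.log (minEntry P.b)| ≤ c₀ * Real.log n) : P.low⁻¹ ≤ (n : ℝ) ^ ⌈c₀⌉₊ := by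
  have hn : (1 : ℝ) ≤ n := by exact_mod_cast hP.n_pos
  have h1 : c₀ * Real.log n ≤ ⌈c₀⌉₊ * Real.log n :=
    mul_le_mul_of_nonneg_right (Nat.le_ceil _) (Real.log_nonneg hn)
  rw [← Real.log_le_log_iff (inv_pos.2 hP.low_pos) (by positivity), Real.log_inv, Real.log_pow,
    hP.log_low]
  have h2 := neg_abs_le (Real.log (minEntry P.a))
  have h3 := neg_abs_le (Real.log (minEntry P.b))
  rcases min_choice (Real.log (minEntry P.a)) (Real.log (minEntry P.b)) with h | h <;> rw [h] <;>
    linarith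

theorem kappa_eq (C : Mat n) (a b : Fin n → ℝ) (ε : ℝ) : kappa a b = (tuned C a b ε).low⁻¹ :=
  one_div _

/-- The step count of the method is `O(κ n² log (n ‖C‖ / ε))`. -/
theorem steps_gemOT_ceil_le (hP : (tuned C a b ε).Admissible) (hε : 0 < ε) (hn : 2 ≤ n)
    (hεN : ε ≤ normInf C) {c₀ : ℝ} (ha : |Real.log (minEntry a)| ≤ c₀ * Real.log n)
    (hb : |Real.log (minEntry b)| ≤ c₀ * Real.log n) {xs : Var n}
    (hxs : (tuned C a b ε).IsDualSolution xs) (c : ℕ) :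
    ((gemOT c ⌈(tuned C a b ε).K₀ (ε / 16) xs⌉₊ C a b ε).steps : ℝ) ≤
      (74 + (52 * (32 + 4 * ⌈c₀⌉₊) + 2) * (2 * c + 26)) *
        (kappa a b * (n : ℝ) ^ 2 * Real.log (n * normInf C / ε)) := by
  have hT := tuned_isTuned hP hε hn hεN
  rw [kappa_eq C a b ε]
  have hd : (tuned C a b ε).low⁻¹ ≤ (n * normInf C / ε) ^ ⌈c₀⌉₊ :=
    (inv_low_le_pow hP ha hb).trans (pow_le_pow_left₀ (Nat.cast_nonneg n) hT.n_le _)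
  have hK := hT.K₀_le hxs hd
  have hK0 : 0 ≤ (tuned C a b ε).K₀ (ε / 16) xs := by
    rw [K₀_eq]
    have := Real.log_pos (hP.one_lt_conditioning hxs (ε / 16))
    have := (tuned C a b ε).root_nonneg
    positivity
  have hk := (Nat.ceil_lt_add_one hK0).le
  have hsteps := steps_gemOT_le hn c ⌈(tuned C a b ε).K₀ (ε / 16) xs⌉₊ C a b ε
  have hsteps' : ((gemOT c ⌈(tuned C a b ε).K₀ (ε / 16) xs⌉₊ C a b ε).steps : ℝ)
      ≤ (37 + ⌈(tuned C a b ε).K₀ (ε / 16) xs⌉₊ * (2 * c + 26)) * (n : ℝ) ^ 2 := by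
    exact_mod_cast hsteps
  refine hsteps'.trans ?_
  have hlog : 1 / 2 ≤ Real.log (n * normInf C / ε) := by
    have h1 := Real.log_le_log two_pos hT.two_le
    linarith [Real.log_two_gt_d9]
  have hκ := hT.inv_low_ge
  generalize Real.log (n * normInf C / ε) = l at *
  generalize (tuned C a b ε).low⁻¹ = κ at *
  -- Absorbs the additive constants: the steps outside the loop (`74 = 2 · 37`) and the rounding up
  -- of `K₀` (the summand `2`).
  have hκl : 1 ≤ 2 * (κ * l) := by nlinarith
  have h1 : (⌈(tuned C a b ε).K₀ (ε / 16) xs⌉₊ : ℝ) ≤ (52 * (32 + 4 * ⌈c₀⌉₊) + 2) * (κ * l) := by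
    linarith
  have h2 := mul_le_mul_of_nonneg_right h1 (show (0 : ℝ) ≤ 2 * c + 26 by positivity)
  have h3 : (37 + ⌈(tuned C a b ε).K₀ (ε / 16) xs⌉₊ * (2 * c + 26) : ℝ)
      ≤ (74 + (52 * (32 + 4 * ⌈c₀⌉₊) + 2) * (2 * c + 26)) * (κ * l) := by
    linarith
  calc _ ≤ (74 + (52 * (32 + 4 * ⌈c₀⌉₊) + 2) * (2 * c + 26)) * (κ * l) * (n : ℝ) ^ 2 :=
        mul_le_mul_of_nonneg_right h3 (by positivity)
    _ = _ := by ring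

end GEM

end

theorem theorem4 (c : ℕ) (c₀ : ℝ) :
    ∃ M : ℝ, 0 < M ∧
      ∀ (n : ℕ) (C : GEM.Mat n) (a b : Fin n → ℝ) (ε : ℝ),
        (∀ i j, 0 ≤ C i j) → C ≠ 0 →
        a ∈ GEM.simplex n → b ∈ GEM.simplex n →
        0 < GEM.minEntry a → 0 < GEM.minEntry b → 0 < ε →
        (∃ xs, (GEM.tuned C a b ε).IsDualSolution xs) ∧
        ∀ xs, (GEM.tuned C a b ε).IsDualSolution xs →
          (∀ k : ℕ, (GEM.tuned C a b ε).K₀ (ε / 16) xs ≤ (k : ℝ) →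
            GEM.IsApproxPlan C a b ε (GEM.gemOT c k C a b ε).val) ∧
          (2 ≤ n → ε ≤ GEM.normInf C →
            |Real.log (GEM.minEntry a)| ≤ c₀ * Real.log n →
            |Real.log (GEM.minEntry b)| ≤ c₀ * Real.log n →
            ((GEM.gemOT c ⌈(GEM.tuned C a b ε).K₀ (ε / 16) xs⌉₊ C a b ε).steps : ℝ) ≤
              M * (GEM.kappa a b * (n : ℝ) ^ 2 *
                Real.log (n * GEM.normInf C / ε))) := by
  refine ⟨74 + (52 * (32 + 4 * ⌈c₀⌉₊) + 2) * (2 * c + 26), by positivity,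
    fun n C a b ε hC hC0 ha hb ha0 hb0 hε => ?_⟩
  have hP := GEM.tuned_admissible hC hC0 ha hb ha0 hb0 hε
  exact ⟨hP.exists_isDualSolution, fun xs hxs =>
    ⟨fun k hk => GEM.gemOT_isApproxPlan hC hC0 ha hb ha0 hb0 hε hxs c hk,
      fun hn hεN hla hlb => GEM.steps_gemOT_ceil_le hP hε hn hεN hla hlb hxs c⟩⟩
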